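/- **Setting.** Let $X$ be a (finite-dimensional) complex manifold, let $\mathscr F \subseteq T_X$ be a subsheaf of $\mathbb C_X$-modules of the sheaf of holomorphic vector fields that is closed under the Lie bracket, and let $Y \subseteq X$ be a reduced complex subspace with inclusion map $f : Y \to X$. Set $\mathscr F_Y := \operatorname{Image}(f^{-1}\mathscr F \to f^*T_X)$. Let $\mathscr G \subseteq \mathscr F_Y$ be an *obstruction sheaf for $\mathscr F$*: a subsheaf of abelian groups such that for every open $U \subseteq X$ and all $\vec A_1, \vec A_2 \in \mathscr F(U)$ with $f^*\vec A_1 = f^*\vec A_2$ one has $f^*[\vec A_1,\vec A_2] \in \mathscr G(f^{-1}(U))$. **Jets.** An $n$-th order jet at $x \in X$ is a morphism of complex spaces $\operatorname{Spec}\mathbb C[t]/t^{n+1} \to X$ that maps the closed point to $x$, i.e. a morphism of $\mathbb C$-algebras $\mathscr O_{X,x} \to \mathbb C[t]/t^{n+1}$; $\operatorname{Jet}^n(X)$ is the manifold of all $n$-th order jets, with the truncation maps $\operatorname{Jet}^{n+1}(X) \to \operatorname{Jet}^n(X)$. A section $Y \to \operatorname{Jet}^n(X)$ over $f$ is a holomorphic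 map that sends each $y \in Y$ to a jet at $f(y)$. **Admissibility.** A *time-dependent vector field in $\mathscr F$* on an open set $U \subseteq X$ is a finite sum $\vec A = \sum_{i=0}^N t^i \vec A_i$ with $\vec A_i \in \mathscr F(U)$, regarded as a vector field on $U \times \mathbb C$. Write $D(\vec A) := \frac{\partial}{\partial t} + \vec A$ and denote by $\mathcal L$ the Lie derivative on $U \times \mathbb C$. For $n \ge 1$, the field $\vec A$ is *$n$-admissible for $\mathscr G$* if, for all $1 \le m \le n$, the restriction of $\mathcal L_{D(\vec A)}^m \vec A$ to time $t = 0$ and to $Y \cap U$ is a section of $\mathscr G$ over $Y \cap U$. For $x \in U$, let $\tau^n_{\vec A}(x)$ be the $n$-th order jet at $x$ of the holomorphic curve germ $\gamma$ with $\gamma(0) = x$ and $\gamma'(t) = \vec A_t(\gamma(t))$. For $n \ge 1$, a section $\tau^n : Y \to \operatorname{Jet}^n(X)$ over $f$ is *admissible for $\mathscr G$* if there are open subsets $U_j \subseteq X$ $(j \in J)$ covering $Y$ and, on each $U_j$, a time-dependent vector field $\vec A_j$ in $\mathscr F$ that is $n$-admissible for $\mathscr G$ and satisfies $\tau^n|_{Y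 \cap U_j} = \tau^n_{\vec A_j}|_{Y \cap U_j}$. **Proposition 4.3 (Lifting admissible sections to arbitrary order).** Suppose that $H^1(Y, \mathscr G) = 0$, and let $n \ge 1$. Then every section $\tau^n : Y \to \operatorname{Jet}^n(X)$ over $f$ that is admissible for $\mathscr G$ lifts to a section $\tau^{n+1} : Y \to \operatorname{Jet}^{n+1}(X)$ over $f$, with $n$-th order truncation $\tau^n$, that is again admissible for $\mathscr G$. -/

import Mathlib

open TopologicalSpace Filter CategoryTheory Opposite
open scoped Manifold Topology ContDiff

universe u

noncomputable section

namespace JetLift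

/-! ### Holomorphic vector fields and subsheaves of the tangent sheaf

Throughout, `X` is a complex manifold modelled on the finite-dimensional complex vector space `E`;
"holomorphic" is `ContMDiff` of order `ω` over `ℂ`. -/

section Fields

variable {E X : Type u} [NormedAddCommGroup E] [NormedSpace ℂ E]
  [TopologicalSpace X] [ChartedSpace E X]

/-- Extension by zero of a vector field given on an open set `U`. It is only used in order to
evaluate local operations (derivatives, Lie brackets, integral curves) at points of `U`. -/
def extendZero {U : Opens X} (A : ∀ x : U, TangentSpace 𝓘(ℂ, E) (x : X)) :
    ∀ x : X, TangentSpace 𝓘(ℂ, E) x :=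
  open scoped Classical in fun x => if h : x ∈ U then A ⟨x, h⟩ else 0

/-- `A` is a holomorphic vector field on `U`, that is, an element of `T_X(U)`. -/
def IsHolomorphicField [IsManifold 𝓘(ℂ, E) 1 X] {U : Opens X}
    (A : ∀ x : U, TangentSpace 𝓘(ℂ, E) (x : X)) : Prop :=
  ContMDiffOn 𝓘(ℂ, E) (𝓘(ℂ, E)).tangent ω
    (fun x : X => (⟨x, extendZero A x⟩ : TangentBundle 𝓘(ℂ, E) X)) U

/-- The Lie bracket of two vector fields on the open set `U`. -/
def lieBracketOn {U : Opens X} (A B : ∀ x : U, TangentSpace 𝓘(ℂ, E) (x : X)) :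
    ∀ x : U, TangentSpace 𝓘(ℂ, E) (x : X) :=
  fun x => VectorField.mlieBracket 𝓘(ℂ, E) (extendZero A) (extendZero B) (x : X)

variable (E X) in
/-- A subsheaf `F ⊆ T_X` of `ℂ_X`-modules. (Invariance under multiplication with locally constant
functions follows from `ℂ`-linearity and the gluing axiom.) -/
structure VectorFieldSheaf [IsManifold 𝓘(ℂ, E) 1 X] where
  /-- the sections over an open set -/
  sec : ∀ U : Opens X, Submodule ℂ (∀ x : U, TangentSpace 𝓘(ℂ, E) (x : X))
  holomorphic : ∀ (U : Opens X), ∀ A ∈ sec U, IsHolomorphicField A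
  restrict : ∀ (U V : Opens X) (h : V ≤ U), ∀ A ∈ sec U, (fun x : V => A ⟨x, h x.2⟩) ∈ sec V
  glue : ∀ (U : Opens X) (A : ∀ x : U, TangentSpace 𝓘(ℂ, E) (x : X)),
    (∀ x : U, ∃ (V : Opens X) (h : V ≤ U), (x : X) ∈ V ∧ (fun z : V => A ⟨z, h z.2⟩) ∈ sec V) →
    A ∈ sec U

/-- `F` is closed under the Lie bracket. -/
def VectorFieldSheaf.LieClosed [IsManifold 𝓘(ℂ, E) 1 X] (F : VectorFieldSheaf E X) : Prop :=
  ∀ U : Opens X, ∀ A ∈ F.sec U, ∀ B ∈ F.sec U, lieBracketOn A B ∈ F.sec U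

variable (E) in
/-- `Y` is the underlying set of a reduced complex subspace of `X`: near each of its points it is
the common zero set of finitely many holomorphic functions. (Closed analytic subsets of `X` are the
main case, but analytic subsets of open subsets of `X` are also allowed. A reduced subspace is
determined by its underlying set.) -/
def IsReducedSubspace (Y : Set X) : Prop :=
  ∀ y ∈ Y, ∃ (U : Opens X) (r : ℕ) (g : Fin r → X → ℂ), y ∈ U ∧
    (∀ i, ContMDiffOn 𝓘(ℂ, E) 𝓘(ℂ) ω (g i) U) ∧ ∀ x ∈ U, (x ∈ Y ↔ ∀ i, g i x = 0)

/-- The open subset `f⁻¹(U) = Y ∩ U` of `Y`, where `f : Y → X` is the inclusion. -/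
def trace (Y : Set X) (U : Opens X) : Opens Y :=
  ⟨{y : Y | (y : X) ∈ U}, U.isOpen.preimage continuous_subtype_val⟩

/-- The pull-back `f^* A`, a section of `f^* T_X` over `Y ∩ U`. As `Y` is reduced, sections of the
locally free sheaf `f^* T_X` are determined by their values and are described by these. -/
def pullback (Y : Set X) {U : Opens X} (A : ∀ x : U, TangentSpace 𝓘(ℂ, E) (x : X)) :
    ∀ y : trace Y U, TangentSpace 𝓘(ℂ, E) ((y : Y) : X) :=
  fun y => A ⟨((y : Y) : X), y.2⟩

/-- The sections over `V ⊆ Y` of the sheaf `F_Y = Image (f⁻¹ F → f^* T_X)` of infinitesimal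
deformations locally induced by `F`: these locally are restrictions of sections of `F`. -/
def VectorFieldSheaf.IsLocallyInduced [IsManifold 𝓘(ℂ, E) 1 X] (F : VectorFieldSheaf E X)
    {Y : Set X} {V : Opens Y} (s : ∀ y : V, TangentSpace 𝓘(ℂ, E) ((y : Y) : X)) : Prop :=
  ∀ y : V, ∃ U : Opens X, ((y : Y) : X) ∈ U ∧ ∃ A ∈ F.sec U,
    ∀ (z : V) (hz : ((z : Y) : X) ∈ U), s z = A ⟨((z : Y) : X), hz⟩

/-- A subsheaf (of abelian groups) `G ⊆ F_Y`. -/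
structure InducedSubsheaf [IsManifold 𝓘(ℂ, E) 1 X] (F : VectorFieldSheaf E X) (Y : Set X) where
  /-- the sections over an open set -/
  sec : ∀ V : Opens Y, AddSubgroup (∀ y : V, TangentSpace 𝓘(ℂ, E) ((y : Y) : X))
  locallyInduced : ∀ (V : Opens Y), ∀ s ∈ sec V, F.IsLocallyInduced s
  restrict : ∀ (V W : Opens Y) (h : W ≤ V), ∀ s ∈ sec V, (fun y : W => s ⟨y, h y.2⟩) ∈ sec W
  glue : ∀ (V : Opens Y) (s : ∀ y : V, TangentSpace 𝓘(ℂ, E) ((y : Y) : X)),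
    (∀ y : V, ∃ (W : Opens Y) (h : W ≤ V), (y : Y) ∈ W ∧ (fun z : W => s ⟨z, h z.2⟩) ∈ sec W) →
    s ∈ sec V

/-- `G` is an obstruction sheaf for `F`: the bracket of any two local sections of `F` that agree
along `Y` induces a section of `G`. -/
def InducedSubsheaf.IsObstructionSheaf [IsManifold 𝓘(ℂ, E) 1 X] {F : VectorFieldSheaf E X}
    {Y : Set X} (G : InducedSubsheaf F Y) : Prop :=
  ∀ U : Opens X, ∀ A₁ ∈ F.sec U, ∀ A₂ ∈ F.sec U, pullback Y A₁ = pullback Y A₂ →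
    pullback Y (lieBracketOn A₁ A₂) ∈ G.sec (trace Y U)

/-! ### The sheaf on the topological space `Y` defined by `G` -/

/-- The presheaf of abelian groups underlying `G`. -/
def InducedSubsheaf.toPresheaf [IsManifold 𝓘(ℂ, E) 1 X] {F : VectorFieldSheaf E X} {Y : Set X}
    (G : InducedSubsheaf F Y) : TopCat.Presheaf AddCommGrpCat.{u} (TopCat.of Y) where
  obj V := AddCommGrpCat.of (G.sec (unop V))
  map {V W} i := AddCommGrpCat.ofHom
    { toFun := fun s => ⟨fun y => s.1 ⟨y, i.unop.le y.2⟩,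
        G.restrict (unop V) (unop W) i.unop.le s.1 s.2⟩
      map_zero' := rfl
      map_add' := fun _ _ => rfl }

theorem InducedSubsheaf.isSheaf_toPresheaf [IsManifold 𝓘(ℂ, E) 1 X] {F : VectorFieldSheaf E X}
    {Y : Set X} (G : InducedSubsheaf F Y) : G.toPresheaf.IsSheaf := by
  rw [TopCat.Presheaf.isSheaf_iff_isSheafUniqueGluing]
  intro ι V sf hsf
  have hex : ∀ y : ↥(iSup V), ∃ i, (y : Y) ∈ V i := fun y => Opens.mem_iSup.mp y.2
  choose idx hidx using hex
  have hcompat : ∀ (i j : ι) (y : Y) (hi : y ∈ V i) (hj : y ∈ V j),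
      (sf i).1 ⟨y, hi⟩ = (sf j).1 ⟨y, hj⟩ := fun i j y hi hj =>
    congrFun (congrArg Subtype.val (hsf i j)) ⟨y, hi, hj⟩
  have hres : ∀ (i : ι), (fun y : V i =>
      (sf (idx ⟨y, Opens.mem_iSup.mpr ⟨i, y.2⟩⟩)).1 ⟨y, hidx ⟨y, Opens.mem_iSup.mpr ⟨i, y.2⟩⟩⟩) =
      (sf i).1 := fun i => funext fun y => hcompat _ _ _ _ _
  refine ⟨⟨fun y => (sf (idx y)).1 ⟨y, hidx y⟩, G.glue _ _ fun y =>
    ⟨V (idx y), le_iSup V _, hidx y, ?_⟩⟩, fun i => Subtype.ext (hres i), ?_⟩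
  · exact (hres (idx y)).symm ▸ (sf (idx y)).2
  · intro s hs
    refine Subtype.ext (funext fun y => ?_)
    exact congrFun (congrArg Subtype.val (hs (idx y))) ⟨y, hidx y⟩

/-- `G` as a sheaf of abelian groups on `Y`. -/
def InducedSubsheaf.toSheaf [IsManifold 𝓘(ℂ, E) 1 X] {F : VectorFieldSheaf E X} {Y : Set X}
    (G : InducedSubsheaf F Y) : TopCat.Sheaf AddCommGrpCat.{u} (TopCat.of Y) :=
  ⟨G.toPresheaf, G.isSheaf_toPresheaf⟩

/-! ### Time-dependent vector fields and admissibility -/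

/-- A time-dependent vector field on `U`, viewed as the vector field `A` on the product with the
time axis `ℂ` that has no component in the direction of `∂/∂t` (extended by zero outside
`U × ℂ`). -/
def horizontal {U : Opens X} (A : ∀ p : U × ℂ, TangentSpace 𝓘(ℂ, E) (p.1 : X)) :
    ∀ p : X × ℂ, TangentSpace (𝓘(ℂ, E).prod 𝓘(ℂ)) p :=
  fun p => ((extendZero fun x : U => A (x, p.2)) p.1, (0 : ℂ))

/-- The vector field `D(A) = ∂/∂t + A` with constant flow in time. -/
def constantFlow {U : Opens X} (A : ∀ p : U × ℂ, TangentSpace 𝓘(ℂ, E) (p.1 : X)) :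
    ∀ p : X × ℂ, TangentSpace (𝓘(ℂ, E).prod 𝓘(ℂ)) p :=
  fun p => ((extendZero fun x : U => A (x, p.2)) p.1, (1 : ℂ))

/-- The restriction to time `t = 0` of the iterated Lie derivative `L_{D(A)}^m A`, as a vector
field on `U` (the field `L_{D(A)}^m A` on `U × ℂ` has no component in the direction of `∂/∂t`). -/
def lieIterateAtZero {U : Opens X} (A : ∀ p : U × ℂ, TangentSpace 𝓘(ℂ, E) (p.1 : X)) (m : ℕ) :
    ∀ x : U, TangentSpace 𝓘(ℂ, E) (x : X) :=
  fun x =>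
    (((VectorField.mlieBracket (𝓘(ℂ, E).prod 𝓘(ℂ)) (constantFlow A))^[m] (horizontal A)
      ((x : X), (0 : ℂ)) : E × ℂ)).1

/-- `A` is a time-dependent vector field in `F`: a finite sum `∑ t^i A_i` with `A_i ∈ F(U)`. -/
def VectorFieldSheaf.IsTimeDependentField [IsManifold 𝓘(ℂ, E) 1 X] (F : VectorFieldSheaf E X)
    {U : Opens X} (A : ∀ p : U × ℂ, TangentSpace 𝓘(ℂ, E) (p.1 : X)) : Prop :=
  ∃ (N : ℕ) (a : ℕ → ∀ x : U, TangentSpace 𝓘(ℂ, E) (x : X)), (∀ i, a i ∈ F.sec U) ∧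
    ∀ (x : U) (t : ℂ), A (x, t) = ∑ i ∈ Finset.range (N + 1), t ^ i • a i x

/-- `A` is a time-dependent vector field in `F` on `U` that is `n`-admissible for (the restriction
to `Y ∩ U` of) `G`. -/
def InducedSubsheaf.IsAdmissibleField [IsManifold 𝓘(ℂ, E) 1 X] {F : VectorFieldSheaf E X}
    {Y : Set X} (G : InducedSubsheaf F Y) (n : ℕ) {U : Opens X}
    (A : ∀ p : U × ℂ, TangentSpace 𝓘(ℂ, E) (p.1 : X)) : Prop :=
  F.IsTimeDependentField A ∧
    ∀ m : ℕ, 1 ≤ m → m ≤ n → pullback Y (lieIterateAtZero A m) ∈ G.sec (trace Y U)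

end Fields

/-! ### Jets -/

section Jets

/-- Germs of functions form an algebra (with the existing ring and module structures). -/
instance germAlgebra {α : Type u} (l : Filter α) : Algebra ℂ (Germ l ℂ) :=
  Algebra.ofModule
    (fun c f g => by
      induction f using Germ.inductionOn
      induction g using Germ.inductionOn
      exact congrArg (fun h : α → ℂ => (h : Germ l ℂ)) (smul_mul_assoc c _ _))
    (fun c f g => by
      induction f using Germ.inductionOn
      induction g using Germ.inductionOn
      exact congrArg (fun h : α → ℂ => (h : Germ l ℂ)) (mul_smul_comm c _ _))

variable {E X : Type u} [NormedAddCommGroup E] [NormedSpace ℂ E]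
  [TopologicalSpace X] [ChartedSpace E X]

variable (E) in
/-- The local ring `O_{X,x}` of germs at `x` of holomorphic functions. -/
def holomorphicGerms (x : X) : Subalgebra ℂ (Germ (𝓝 x) ℂ) where
  carrier := {φ | ∃ g : X → ℂ, ContMDiffAt 𝓘(ℂ, E) 𝓘(ℂ) ω g x ∧ φ = (g : Germ (𝓝 x) ℂ)}
  mul_mem' := by
    rintro _ _ ⟨g, hg, rfl⟩ ⟨h, hh, rfl⟩
    exact ⟨g * h, hg.mul hh, rfl⟩
  add_mem' := by
    rintro _ _ ⟨g, hg, rfl⟩ ⟨h, hh, rfl⟩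
    exact ⟨g + h, hg.add hh, rfl⟩
  algebraMap_mem' := by
    intro c
    refine ⟨fun _ => c, contMDiffAt_const, ?_⟩
    rw [Algebra.algebraMap_eq_smul_one]
    refine congrArg (fun f : X → ℂ => (f : Germ (𝓝 x) ℂ)) (funext fun _ => ?_)
    simp

/-- The germ at `x` of a function that is holomorphic near `x`. -/
def germAt {x : X} (g : X → ℂ) (hg : ContMDiffAt 𝓘(ℂ, E) 𝓘(ℂ) ω g x) : holomorphicGerms E x :=
  ⟨(g : Germ (𝓝 x) ℂ), g, hg, rfl⟩

/-- The ring `ℂ[t]/t^{n+1}`. -/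
abbrev TruncatedPolynomial (n : ℕ) : Type :=
  Polynomial ℂ ⧸ Ideal.span {(Polynomial.X : Polynomial ℂ) ^ (n + 1)}

/-- The class of `∑_{k ≤ n} c_k t^k` in `ℂ[t]/t^{n+1}`. -/
def truncatedSum (n : ℕ) (c : ℕ → ℂ) : TruncatedPolynomial n :=
  Ideal.Quotient.mk _ (∑ k ∈ Finset.range (n + 1), Polynomial.C (c k) * Polynomial.X ^ k)

variable (E) in
/-- An `n`-th order jet at `x`: a morphism `Spec ℂ[t]/t^{n+1} → X` that maps the closed point to
`x`, in other words a morphism of `ℂ`-algebras `O_{X,x} → ℂ[t]/t^{n+1}` (which is automatically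
local). -/
abbrev Jet (n : ℕ) (x : X) : Type u :=
  holomorphicGerms E x →ₐ[ℂ] TruncatedPolynomial n

/-- The forgetful map `Jet^{n+1}(X) → Jet^n(X)`. -/
def Jet.truncate {n : ℕ} {x : X} (σ : Jet E (n + 1) x) : Jet E n x :=
  (Ideal.Quotient.factorₐ ℂ (Ideal.span_singleton_le_span_singleton.mpr
    (pow_dvd_pow (Polynomial.X : Polynomial ℂ) (Nat.le_succ (n + 1))))).comp σ

/-- `σ` is the `n`-th order jet at `γ(0) = x` of the curve germ `γ`: it maps the germ of `g` to the
`n`-th order Taylor polynomial of `g ∘ γ` at `0`. -/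
def Jet.IsJetOf {n : ℕ} {x : X} (σ : Jet E n x) (γ : ℂ → X) : Prop :=
  ∀ (g : X → ℂ) (hg : ContMDiffAt 𝓘(ℂ, E) 𝓘(ℂ) ω g x),
    σ (germAt g hg) = truncatedSum n fun k => (k.factorial : ℂ)⁻¹ * iteratedDeriv k (g ∘ γ) 0

/-- `γ` represents the germ at time `0` of the integral curve through `x` of the time-dependent
vector field `A`: `γ(0) = x` and `γ'(t) = A_t(γ(t))` for all `t` near `0`. Here `t` is a complex
variable, so that `γ` is holomorphic near `0`. -/
def IsIntegralCurveGerm {U : Opens X} (A : ∀ p : U × ℂ, TangentSpace 𝓘(ℂ, E) (p.1 : X))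
    (x : X) (γ : ℂ → X) : Prop :=
  γ 0 = x ∧ ∀ᶠ t in 𝓝 (0 : ℂ), HasMFDerivAt 𝓘(ℂ) 𝓘(ℂ, E) γ t
    ((1 : ℂ →L[ℂ] ℂ).smulRight ((extendZero fun x : U => A (x, t)) (γ t)))

/-- `σ = τ^n_A(x)`, the `n`-th order jet at `x` of the `A`-integral curve through `x`. -/
def Jet.IsInducedBy {n : ℕ} {x : X} (σ : Jet E n x) {U : Opens X}
    (A : ∀ p : U × ℂ, TangentSpace 𝓘(ℂ, E) (p.1 : X)) : Prop :=
  ∃ γ : ℂ → X, IsIntegralCurveGerm A x γ ∧ σ.IsJetOf γ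

variable (E) in
/-- A (holomorphic) section `τ : Y → Jet^n(X)` over the inclusion `f : Y → X` of a reduced complex
subspace. Holomorphy means that for each local holomorphic function `g` on `X`, the coefficients of
`τ(y)(g) ∈ ℂ[t]/t^{n+1}` are holomorphic functions of `y ∈ Y`, that is, locally restrictions of
holomorphic functions on `X`; equivalently, the map `g ↦ (y ↦ τ(y)(g))` is a morphism
`O_X|_Y → O_Y[t]/t^{n+1}`. -/
structure JetSection (Y : Set X) (n : ℕ) where
  /-- the underlying map -/
  toFun : ∀ y : Y, Jet E n (y : X)
  holomorphic : ∀ (y₀ : Y) (g : X → ℂ), ContMDiffAt 𝓘(ℂ, E) 𝓘(ℂ) ω g (y₀ : X) →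
    ∃ c : ℕ → X → ℂ, (∀ k, ContMDiffAt 𝓘(ℂ, E) 𝓘(ℂ) ω (c k) (y₀ : X)) ∧
      ∀ᶠ y : Y in 𝓝 y₀, ∀ hg : ContMDiffAt 𝓘(ℂ, E) 𝓘(ℂ) ω g (y : X),
        toFun y (germAt g hg) = truncatedSum n fun k => c k (y : X)

/-- The section `τ` of `Jet^n(X)` over `f` is admissible for `G`: there is a cover of `Y` by open
subsets of `X` and on each of these an `n`-admissible time-dependent vector field that induces
`τ`. -/
def JetSection.IsAdmissible [IsManifold 𝓘(ℂ, E) 1 X] {Y : Set X} {n : ℕ} (τ : JetSection E Y n)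
    {F : VectorFieldSheaf E X} (G : InducedSubsheaf F Y) : Prop :=
  ∃ (J : Type u) (U : J → Opens X) (A : ∀ j, ∀ p : U j × ℂ, TangentSpace 𝓘(ℂ, E) (p.1 : X)),
    (∀ y ∈ Y, ∃ j, y ∈ U j) ∧
    (∀ j, G.IsAdmissibleField n (A j)) ∧
    ∀ (j : J) (y : Y), (y : X) ∈ U j → (τ.toFun y).IsInducedBy (A j)

end Jets

end JetLift

end

/-!
# Lifting admissible jet sections

Time-dependent fields in `F` over `U` are treated algebraically, as elements of the Lie algebra
`F(U)[t]` of polynomials with coefficients in the Lie algebra `F(U)` (`CurrentAlgebra`,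
`timeField`). On it, the Lie derivative along `∂/∂t + a` is the derivation `flowDeriv a = ∂/∂t +
[a, -]` (`mlieBracket_constantFlow_horizontal`), and `n`-admissibility of `a` says that `(flowDeriv
a)^m a` at `t = 0` induces a section of `G` for `1 ≤ m ≤ n`. On the other side, the jet induced by
`a` at `x` sends `g` to the Taylor polynomial with coefficients `flowTaylor a g k x / k!`, where
`flowTaylor a g k x` is the `k`-th derivative of `g` along `∂/∂t + a` at `(x, 0)`
(`isInducedBy_timeField_iff`). Integral curves of a field enter only through the existence theorem
for holomorphic differential equations, `exists_eventually_hasDerivAt`.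

Two comparisons of `a` with `a + c` carry the argument.

* If `(flowDeriv a)^i c` vanishes at `(x, 0)` for `i < k`, then the jets of order `k` at `x` agree
  and the Taylor coefficients of order `k + 1` differ by the tangent vector `(flowDeriv a)^k c` at
  `(x, 0)` (`flowTaylor_add`).
* If `(flowDeriv a)^i c` vanishes along `Y` at `t = 0` for `i < m`, then the obstructions
  `(flowDeriv (a + c))^m (a + c)` and `(flowDeriv a)^m a` differ by `(flowDeriv a)^m c` modulo
  sections of `G` (`evalTime_iterate_flowDeriv_sub_mem`), because a bracket with a field that
  vanishes along `Y` induces a section of `G`.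

If `a i` and `a j` are two of the `n`-admissible fields that define `τ`, their `n`-jets agree along
`Y`, so both comparisons apply to `c = a j - a i`: the tangent vectors by which their jets of order
`n + 1` differ form a section of `G` (`InducedSubsheaf.exists_sec_flowTaylor_sub`). These sections
are a cocycle, and since `H¹(Y, G) = 0` it is the coboundary of sections `s j` of `G`
(`InducedSubsheaf.exists_global_section`). Locally `s j` is the restriction of some `B` in `F`, and
adding `-tⁿ B / n!` to `a j` changes the jet of order `n + 1` by `-s j`, the obstruction of order
`n` by `-s j` as well, and nothing of lower order. So `n`-admissibility is kept and the jets of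
order `n + 1` glue. A further term `tⁿ⁺¹ B'` does not affect jets of order `n + 1` and makes the
obstruction of order `n + 1` vanish modulo `G` (`InducedSubsheaf.exists_isAdmissibleField_succ`).
-/

universe w

noncomputable section

namespace JetLift

open VectorField VectorFieldSheaf
open scoped TensorProduct Polynomial

/-! ### Polynomials in time with coefficients in a Lie algebra -/

section CurrentAlgebra

variable {L : Type*} [LieRing L] [LieAlgebra ℂ L]

variable (L) in
/-- The Lie algebra `L[t]` of polynomials `∑ tⁱ aᵢ` with coefficients in the Lie algebra `L`. -/
def CurrentAlgebra : Type _ := ℂ[X] ⊗[ℂ] L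

instance : LieRing (CurrentAlgebra L) := LieAlgebra.ExtendScalars.instLieRing ℂ ℂ[X] L

instance : LieAlgebra ℂ[X] (CurrentAlgebra L) := LieAlgebra.ExtendScalars.instLieAlgebra ℂ ℂ[X] L

instance : LieAlgebra ℂ (CurrentAlgebra L) := LieAlgebra.ExtendScalars.instBaseLieAlgebra ℂ ℂ[X] L

instance : IsScalarTower ℂ ℂ[X] (CurrentAlgebra L) :=
  inferInstanceAs (IsScalarTower ℂ ℂ[X] (ℂ[X] ⊗[ℂ] L))

/-- The element `p(t) x` of `L[t]`. -/
def monomialTerm (p : ℂ[X]) (x : L) : CurrentAlgebra L := p ⊗ₜ[ℂ] x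

@[elab_as_elim]
lemma CurrentAlgebra.induction {motive : CurrentAlgebra L → Prop} (a : CurrentAlgebra L)
    (zero : motive 0) (tmul : ∀ p x, motive (monomialTerm p x))
    (add : ∀ a b, motive a → motive b → motive (a + b)) : motive a :=
  TensorProduct.induction_on a zero tmul add

lemma monomialTerm_lie (p q : ℂ[X]) (x y : L) :
    ⁅monomialTerm p x, monomialTerm q y⁆ = monomialTerm (p * q) ⁅x, y⁆ := rfl

lemma add_monomialTerm (p q : ℂ[X]) (x : L) :
    monomialTerm (p + q) x = monomialTerm p x + monomialTerm q x := TensorProduct.add_tmul p q x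

lemma smul_monomialTerm (p q : ℂ[X]) (x : L) :
    p • monomialTerm q x = monomialTerm (p * q) x := rfl

/-- Differentiation `∂/∂t` of the polynomials `∑ tⁱ aᵢ` with coefficients in `L`. -/
def timeDeriv : CurrentAlgebra L →ₗ[ℂ] CurrentAlgebra L :=
  LinearMap.rTensor L Polynomial.derivative

/-- Evaluation of a polynomial with coefficients in the Lie algebra `L` at the time `t`. -/
def evalTime (t : ℂ) : CurrentAlgebra L →ₗ[ℂ] L :=
  (TensorProduct.lid ℂ L).toLinearMap ∘ₗ LinearMap.rTensor L (Polynomial.leval t)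

@[simp] lemma timeDeriv_tmul (p : ℂ[X]) (x : L) :
    timeDeriv (monomialTerm p x) = monomialTerm (Polynomial.derivative p) x := rfl

@[simp] lemma evalTime_tmul (t : ℂ) (p : ℂ[X]) (x : L) :
    evalTime t (monomialTerm p x) = p.eval t • x := rfl

lemma timeDeriv_lie (a b : CurrentAlgebra L) :
    timeDeriv ⁅a, b⁆ = ⁅timeDeriv a, b⁆ + ⁅a, timeDeriv b⁆ := by
  induction a using CurrentAlgebra.induction with
  | zero => simp
  | add a a' ha ha' => simp only [add_lie, map_add, ha, ha']; abel
  | tmul p x =>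
    induction b using CurrentAlgebra.induction with
    | zero => simp
    | add b b' hb hb' => simp only [lie_add, map_add, hb, hb']; abel
    | tmul q y =>
      simp [monomialTerm_lie, add_monomialTerm]

lemma evalTime_lie (t : ℂ) (a b : CurrentAlgebra L) :
    evalTime t ⁅a, b⁆ = ⁅evalTime t a, evalTime t b⁆ := by
  induction a using CurrentAlgebra.induction with
  | zero => simp
  | add a a' ha ha' => simp only [add_lie, map_add, ha, ha']
  | tmul p x =>
    induction b using CurrentAlgebra.induction with
    | zero => simp
    | add b b' hb hb' => simp only [lie_add, map_add, hb, hb']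
    | tmul q y =>
      simp [monomialTerm_lie, smul_smul, mul_comm]

lemma timeDeriv_smul (p : ℂ[X]) (a : CurrentAlgebra L) :
    timeDeriv (p • a) = Polynomial.derivative p • a + p • timeDeriv a := by
  induction a using CurrentAlgebra.induction with
  | zero => simp
  | add a a' ha ha' => simp only [smul_add, map_add, ha, ha']; abel
  | tmul q x => simp [smul_monomialTerm, add_monomialTerm]

lemma evalTime_smul (t : ℂ) (p : ℂ[X]) (a : CurrentAlgebra L) :
    evalTime t (p • a) = p.eval t • evalTime t a := by
  induction a using CurrentAlgebra.induction with
  | zero => simp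
  | add a a' ha ha' => simp only [smul_add, map_add, ha, ha']
  | tmul q x => simp [smul_monomialTerm, smul_smul]

/-- The Lie derivative along `∂/∂t + a`, as an operator on polynomials with coefficients in `L`. -/
def flowDeriv (a : CurrentAlgebra L) : CurrentAlgebra L →ₗ[ℂ] CurrentAlgebra L where
  toFun v := timeDeriv v + ⁅a, v⁆
  map_add' v w := by simp only [map_add, lie_add]; abel
  map_smul' c v := by simp

lemma flowDeriv_apply (a v : CurrentAlgebra L) : flowDeriv a v = timeDeriv v + ⁅a, v⁆ := rfl

lemma flowDeriv_lie (a v w : CurrentAlgebra L) :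
    flowDeriv a ⁅v, w⁆ = ⁅flowDeriv a v, w⁆ + ⁅v, flowDeriv a w⁆ := by
  simp only [flowDeriv_apply, timeDeriv_lie, add_lie, lie_add, leibniz_lie a v w]
  abel

lemma flowDeriv_add_left (a c v : CurrentAlgebra L) :
    flowDeriv (a + c) v = flowDeriv a v + ⁅c, v⁆ := by
  simp only [flowDeriv_apply, add_lie, add_assoc]

/-- Iterated Lie derivatives of a bracket `⁅c, w⁆` lie in `H` at time `0` as soon as those of `c`
lie in `K` and `⁅K, L⁆ ⊆ H`. -/
lemma evalTime_iterate_flowDeriv_lie_mem {K : Set L} {H : AddSubgroup L}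
    (hKH : ∀ x ∈ K, ∀ y : L, ⁅x, y⁆ ∈ H) (a : CurrentAlgebra L) (q : ℕ) :
    ∀ c w : CurrentAlgebra L, (∀ k ≤ q, evalTime 0 ((flowDeriv a)^[k] c) ∈ K) →
      evalTime 0 ((flowDeriv a)^[q] ⁅c, w⁆) ∈ H := by
  induction q with
  | zero =>
    intro c w hc
    simpa [evalTime_lie] using hKH _ (hc 0 le_rfl) _
  | succ q ih =>
    intro c w hc
    rw [Function.iterate_succ_apply, flowDeriv_lie, iterate_map_add, map_add]
    refine H.add_mem (ih _ _ fun k hk => ?_) (ih _ _ fun k hk => hc k (by omega))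
    simpa only [Function.iterate_succ_apply] using hc (k + 1) (by omega)

/-- Comparison of the iterated Lie derivatives of two time-dependent elements `a` and `a + c` along
their own flows: modulo `H`, the difference is the iterated Lie derivative of `c` along `a`. -/
lemma evalTime_iterate_flowDeriv_sub_mem {K : Set L} {H : AddSubgroup L}
    (hKH : ∀ x ∈ K, ∀ y : L, ⁅x, y⁆ ∈ H) (a c : CurrentAlgebra L) (m : ℕ)
    (hc : ∀ k < m, evalTime 0 ((flowDeriv a)^[k] c) ∈ K) :
    evalTime 0 ((flowDeriv (a + c))^[m] (a + c)) - evalTime 0 ((flowDeriv a)^[m] a)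
      - evalTime 0 ((flowDeriv a)^[m] c) ∈ H := by
  -- Replacing the operators of `a + c` by those of `a` one at a time, starting with the innermost
  -- one that is left, changes the result by a bracket with `c`.
  have key : ∀ (m j : ℕ), (∀ k < m + j, evalTime 0 ((flowDeriv a)^[k] c) ∈ K) →
      evalTime 0 ((flowDeriv a)^[j] ((flowDeriv (a + c))^[m] (a + c)))
        - evalTime 0 ((flowDeriv a)^[m + j] (a + c)) ∈ H := by
    intro m
    induction m with
    | zero => intro j _; simp
    | succ m ih =>
      intro j hk
      rw [Function.iterate_succ_apply', flowDeriv_add_left, iterate_map_add, map_add,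
        ← Function.iterate_succ_apply, add_sub_right_comm]
      refine H.add_mem ?_ (evalTime_iterate_flowDeriv_lie_mem hKH a j _ _
        fun k hkj => hk k (by omega))
      have := ih (j + 1) fun k hk' => hk k (by omega)
      rwa [show m + 1 + j = m + (j + 1) by omega]
  have := key m 0 (by simpa using hc)
  simpa [iterate_map_add, sub_sub] using this

/-- Up to terms of higher order in `t`, applying `∂/∂t + [a, -]` to `tⁿ w` amounts to
differentiating `tⁿ`. -/
lemma exists_iterate_flowDeriv_X_pow_smul (a w : CurrentAlgebra L) (n i : ℕ) (hi : i ≤ n) :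
    ∃ w', (flowDeriv a)^[i] ((Polynomial.X ^ n : ℂ[X]) • w) =
      (Polynomial.X ^ (n - i) : ℂ[X]) •
        ((n.descFactorial i : ℂ) • w + (Polynomial.X : ℂ[X]) • w') := by
  induction i with
  | zero => exact ⟨0, by simp⟩
  | succ i ih =>
    obtain ⟨w', hw'⟩ := ih (by omega)
    obtain ⟨r, hr⟩ : ∃ r, n - i = r + 1 := ⟨n - i - 1, by omega⟩
    have hr' : n - (i + 1) = r := by omega
    refine ⟨((r + 1 : ℕ) : ℂ) • w' + flowDeriv a ((n.descFactorial i : ℂ) • w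
      + (Polynomial.X : ℂ[X]) • w'), ?_⟩
    rw [Function.iterate_succ_apply', hw', hr, hr', Nat.descFactorial_succ, hr]
    rw [flowDeriv_apply, timeDeriv_smul, lie_smul, add_assoc, ← smul_add, ← flowDeriv_apply]
    generalize flowDeriv a ((n.descFactorial i : ℂ) • w + (Polynomial.X : ℂ[X]) • w') = z
    have hder : Polynomial.derivative (Polynomial.X ^ (r + 1) : ℂ[X])
        = (Polynomial.X ^ r : ℂ[X]) * Polynomial.C ((r + 1 : ℕ) : ℂ) := by
      rw [Polynomial.derivative_X_pow, mul_comm]; simp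
    have hC : ∀ (d : ℂ) (v : CurrentAlgebra L), Polynomial.C d • v = d • v := by
      intro d v
      exact algebraMap_smul ℂ[X] d v
    rw [hder, mul_smul, hC, pow_succ, mul_smul, ← smul_add]
    congr 1
    simp only [smul_add, Nat.cast_mul, mul_smul,
      smul_comm ((r + 1 : ℕ) : ℂ) (Polynomial.X : ℂ[X]) w']
    abel

lemma evalTime_iterate_flowDeriv_X_pow_smul_of_lt (a w : CurrentAlgebra L) {n i : ℕ} (hi : i < n) :
    evalTime 0 ((flowDeriv a)^[i] ((Polynomial.X ^ n : ℂ[X]) • w)) = 0 := by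
  obtain ⟨w', h⟩ := exists_iterate_flowDeriv_X_pow_smul a w n i hi.le
  rw [h, evalTime_smul]
  simp [show n - i ≠ 0 by omega]

lemma evalTime_iterate_flowDeriv_X_pow_smul_self (a w : CurrentAlgebra L) (n : ℕ) :
    evalTime 0 ((flowDeriv a)^[n] ((Polynomial.X ^ n : ℂ[X]) • w)) =
      (n.factorial : ℂ) • evalTime 0 w := by
  obtain ⟨w', h⟩ := exists_iterate_flowDeriv_X_pow_smul a w n n le_rfl
  rw [h, evalTime_smul, map_add, evalTime_smul]
  simp [Nat.descFactorial_self]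

end CurrentAlgebra

/-! ### Vanishing of the first cohomology and global sections -/

section Torsor

open Limits in
/-- Sections of a sheaf that are killed by the quotient map `P ⟶ P / G` come from `G`. -/
lemma exists_section_of_cokernel_eq_zero {Y : TopCat.{u}}
    {G P : Sheaf (Opens.grothendieckTopology Y) AddCommGrpCat.{u}} (f : G ⟶ P) [Mono f]
    (V : Opens Y)
    (s : ToType (P.obj.obj (op V))) (hs : (cokernel.π f).hom.app (op V) s = 0) :
    ∃ r : ToType (G.obj.obj (op V)), f.hom.app (op V) r = s := by
  let S : ShortComplex (Sheaf (Opens.grothendieckTopology Y) AddCommGrpCat.{u}) :=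
    ShortComplex.mk f (cokernel.π f) (cokernel.condition f)
  have hS : S.Exact := ShortComplex.exact_cokernel f
  let Φ : Sheaf (Opens.grothendieckTopology Y) AddCommGrpCat.{u} ⥤ AddCommGrpCat.{u} :=
    sheafToPresheaf _ _ ⋙ (evaluation _ _).obj (op V)
  have : Mono S.f := inferInstanceAs (Mono f)
  have : Functor.PreservesZeroMorphisms Φ := ⟨fun _ _ => rfl⟩
  have : PreservesLimitsOfShape WalkingParallelPair Φ := by
    dsimp only [Φ]; infer_instance
  have h := hS.map_of_mono_of_preservesKernel Φ inferInstance inferInstance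
  rw [ShortComplex.ab_exact_iff] at h
  exact h s hs

open Limits in
/-- If `H¹(Y, G) = 0`, then local sections of a sheaf `P ⊇ G` that differ by sections of `G` can be
corrected by sections of `G` to a global section of `P`. -/
theorem exists_global_section_of_subsingleton_H_one {Y : TopCat.{u}}
    {G P : Sheaf (Opens.grothendieckTopology Y) AddCommGrpCat.{u}} (f : G ⟶ P) [Mono f]
    [HasExt.{w} (Sheaf (Opens.grothendieckTopology Y) AddCommGrpCat.{u})]
    (hH : Subsingleton (Sheaf.H G 1)) {ι : Type u} (V : ι → Opens Y) (hV : ⊤ ≤ iSup V)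
    (h : ∀ i, ToType (P.obj.obj (op (V i))))
    (g : ∀ i j, ToType (G.obj.obj (op (V i ⊓ V j))))
    (hg : ∀ i j, f.hom.app (op (V i ⊓ V j)) (g i j) =
      P.obj.map (Opens.infLELeft (V i) (V j)).op (h i)
        - P.obj.map (Opens.infLERight (V i) (V j)).op (h j)) :
    ∃ p : ToType (P.obj.obj (op ⊤)), ∀ i, ∃ s : ToType (G.obj.obj (op (V i))),
      f.hom.app (op (V i)) s = h i - P.obj.map (homOfLE le_top).op p := by
  let S : ShortComplex (Sheaf (Opens.grothendieckTopology Y) AddCommGrpCat.{u}) :=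
    ShortComplex.mk f (cokernel.π f) (cokernel.condition f)
  have : Mono S.f := inferInstanceAs (Mono f)
  have : Epi S.g := inferInstanceAs (Epi (cokernel.π f))
  have hS : S.ShortExact := ⟨ShortComplex.exact_cokernel f⟩
  let π : P ⟶ cokernel f := cokernel.π f
  have hnat : ∀ {U W : Opens Y} (i : U ⟶ W) (x : ToType (P.obj.obj (op W))),
      π.hom.app (op U) (P.obj.map i.op x) = (cokernel f).obj.map i.op (π.hom.app (op W) x) :=
    fun i x => ConcreteCategory.congr_hom (π.hom.naturality i.op) x
  have hfπ : ∀ (U : Opens Y) (r : ToType (G.obj.obj (op U))),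
      π.hom.app (op U) (f.hom.app (op U) r) = 0 := fun U r => by
    have := congrArg (fun k : G ⟶ cokernel f => k.hom.app (op U)) (cokernel.condition f)
    exact ConcreteCategory.congr_hom this r
  obtain ⟨q, hq, -⟩ := TopCat.Sheaf.existsUnique_gluing' (X := Y) (cokernel f) V ⊤
    (fun i => homOfLE le_top) hV (fun i => π.hom.app (op (V i)) (h i)) (fun i j => by
      rw [← sub_eq_zero]
      have := hfπ _ (g i j)
      rw [hg, map_sub, hnat, hnat] at this
      exact this)
  have hT : IsTerminal (⊤ : Opens Y) := isTerminalTop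
  let e := (Sheaf.H.equiv₀ (cokernel f) hT).symm q
  obtain ⟨x, hx⟩ := Abelian.Ext.covariant_sequence_exact₃
    ((constantSheaf (Opens.grothendieckTopology Y) AddCommGrpCat.{u}).obj
      (AddCommGrpCat.of (ULift ℤ))) hS e (zero_add 1) (hH.elim _ _)
  have hpq : π.hom.app (op ⊤) (Sheaf.H.equiv₀ P hT x) = q := by
    rw [Sheaf.H.equiv₀_naturality]
    have : Sheaf.H.map π 0 x = e := hx
    rw [this]
    exact AddEquiv.apply_symm_apply _ _
  refine ⟨Sheaf.H.equiv₀ P hT x, fun i => ?_⟩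
  refine exists_section_of_cokernel_eq_zero f (V i) _ ?_
  change π.hom.app (op (V i)) _ = 0
  rw [map_sub, hnat, hpq]
  exact sub_eq_zero.mpr (hq i).symm

variable {E X : Type u} [NormedAddCommGroup E] [NormedSpace ℂ E]
  [TopologicalSpace X] [ChartedSpace E X]

variable (E) in
/-- The presheaf of all set-theoretic sections of `f^* T_X`, with no continuity required. It serves
as an ambient sheaf of `G`; no exactness on its part is needed. -/
def discontinuousPresheaf (Y : Set X) : TopCat.Presheaf AddCommGrpCat.{u} (TopCat.of Y) where
  obj V := AddCommGrpCat.of (∀ y : (unop V : Opens Y), TangentSpace 𝓘(ℂ, E) ((y : Y) : X))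
  map {V W} i := AddCommGrpCat.ofHom
    { toFun := fun s y => s ⟨y, i.unop.le y.2⟩
      map_zero' := rfl
      map_add' := fun _ _ => rfl }

lemma isSheaf_discontinuousPresheaf (Y : Set X) : (discontinuousPresheaf E Y).IsSheaf := by
  rw [TopCat.Presheaf.isSheaf_iff_isSheafUniqueGluing]
  intro ι V sf hsf
  have hex : ∀ y : ↥(iSup V), ∃ i, (y : Y) ∈ V i := fun y => Opens.mem_iSup.mp y.2
  choose idx hidx using hex
  have hcompat : ∀ (i j : ι) (y : Y) (hi : y ∈ V i) (hj : y ∈ V j),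
      sf i ⟨y, hi⟩ = sf j ⟨y, hj⟩ := fun i j y hi hj => congrFun (hsf i j) ⟨y, hi, hj⟩
  refine ⟨fun y => sf (idx y) ⟨y, hidx y⟩, fun i => funext fun y => hcompat _ _ _ _ _,
    fun s hs => funext fun y => ?_⟩
  exact congrFun (hs (idx y)) ⟨y, hidx y⟩

variable (E) in
/-- The sheaf of all set-theoretic sections of `f^* T_X`. -/
def discontinuousSheaf (Y : Set X) :
    Sheaf (Opens.grothendieckTopology (TopCat.of Y)) AddCommGrpCat.{u} :=
  ⟨discontinuousPresheaf E Y, isSheaf_discontinuousPresheaf Y⟩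

variable [IsManifold 𝓘(ℂ, E) 1 X] {F : VectorFieldSheaf E X} {Y : Set X}

/-- The inclusion of `G` into the sheaf of all sections of `f^* T_X`. -/
def InducedSubsheaf.inclusion (G : InducedSubsheaf F Y) :
    Quiver.Hom (V := Sheaf (Opens.grothendieckTopology (TopCat.of Y)) AddCommGrpCat.{u})
      G.toSheaf (discontinuousSheaf E Y) :=
  ⟨{ app := fun V => AddCommGrpCat.ofHom (G.sec (unop V)).subtype
     naturality := fun _ _ _ => rfl }⟩

instance (G : InducedSubsheaf F Y) :
    Mono (C := Sheaf (Opens.grothendieckTopology (TopCat.of Y)) AddCommGrpCat.{u}) G.inclusion := by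
  have : ∀ V, Mono (G.inclusion.hom.app V) := fun V => by
    rw [AddCommGrpCat.mono_iff_injective]
    exact Subtype.val_injective
  have : Mono G.inclusion.hom := NatTrans.mono_of_mono_app _
  exact (sheafToPresheaf _ _).mono_of_mono_map this

/-- If `H¹(Y, G) = 0`, then sections `h i` of `f^* T_X` over the members of a cover that differ by
sections of `G` can be corrected by sections of `G` to a global section. -/
theorem InducedSubsheaf.exists_global_section (G : InducedSubsheaf F Y)
    (hH : Subsingleton (Sheaf.H G.toSheaf 1)) {ι : Type u} (V : ι → Opens Y)
    (hV : ∀ y, ∃ i, y ∈ V i) (h : ∀ i, ∀ y : V i, TangentSpace 𝓘(ℂ, E) ((y : Y) : X))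
    (hdiff : ∀ i j, (fun y : (V i ⊓ V j : Opens Y) => h i ⟨y, y.2.1⟩ - h j ⟨y, y.2.2⟩) ∈
      G.sec (V i ⊓ V j)) :
    ∃ p : ∀ y : Y, TangentSpace 𝓘(ℂ, E) (y : X),
      ∀ i, (fun y : V i => h i y - p y) ∈ G.sec (V i) := by
  obtain ⟨p, hp⟩ := exists_global_section_of_subsingleton_H_one G.inclusion hH V
    (fun y _ => Opens.mem_iSup.mpr (hV y)) h (fun i j => ⟨_, hdiff i j⟩) (fun i j => rfl)
  refine ⟨fun y => p ⟨y, trivial⟩, fun i => ?_⟩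
  obtain ⟨s, hs⟩ := hp i
  have hs' : s.1 = fun y : V i => h i y - p ⟨y, trivial⟩ := hs
  exact hs' ▸ s.2

end Torsor

/-! ### Derivatives of functions along vector fields -/

section FieldDeriv

variable {B H M F : Type*} [NormedAddCommGroup B] [NormedSpace ℂ B] [TopologicalSpace H]
  {I : ModelWithCorners ℂ B H} [TopologicalSpace M] [ChartedSpace H M]
  [NormedAddCommGroup F] [NormedSpace ℂ F]

variable (I) in
/-- The derivative of the vector-valued function `f` in the direction of the vector field `V`. -/
def fieldDeriv (V : ∀ p : M, TangentSpace I p) (f : M → F) : M → F :=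
  fun p => mfderiv I 𝓘(ℂ, F) f p (V p)

lemma fieldDeriv_congr {V W : ∀ p : M, TangentSpace I p} {f g : M → F} {p : M}
    (hV : V p = W p) (hf : f =ᶠ[𝓝 p] g) : fieldDeriv I V f p = fieldDeriv I W g p := by
  unfold fieldDeriv
  rw [hV]
  exact congrArg (fun L : B →L[ℂ] F => L (W p)) hf.mfderiv_eq

lemma fieldDeriv_eq_zero {V : ∀ p : M, TangentSpace I p} {f : M → F} {p : M} (hV : V p = 0) :
    fieldDeriv I V f p = 0 :=
  (congrArg (mfderiv I 𝓘(ℂ, F) f p : B → F) hV).trans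
    (map_zero (mfderiv I 𝓘(ℂ, F) f p : B →L[ℂ] F))

lemma fieldDeriv_add {V : ∀ p : M, TangentSpace I p} {f g : M → F} {p : M}
    (hf : MDifferentiableAt I 𝓘(ℂ, F) f p) (hg : MDifferentiableAt I 𝓘(ℂ, F) g p) :
    fieldDeriv I V (f + g) p = fieldDeriv I V f p + fieldDeriv I V g p :=
  congrArg (fun L : B →L[ℂ] F => L (V p)) (mfderiv_add hf hg)

lemma fieldDeriv_sub_left (V W : ∀ p : M, TangentSpace I p) (f : M → F) (p : M) :
    fieldDeriv I (W - V) f p = fieldDeriv I W f p - fieldDeriv I V f p :=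
  map_sub (mfderiv I 𝓘(ℂ, F) f p) (W p) (V p)

lemma contMDiffAt_fieldDeriv [IsManifold I ω M] {V : ∀ p : M, TangentSpace I p} {f : M → F}
    {p : M} (hV : ContMDiffAt I I.tangent ω (fun q => (⟨q, V q⟩ : TangentBundle I M)) p)
    (hf : ContMDiffAt I 𝓘(ℂ, F) ω f p) : ContMDiffAt I 𝓘(ℂ, F) ω (fieldDeriv I V f) p := by
  obtain ⟨u, hu, hfu⟩ := (contMDiffAt_iff_contMDiffOn_nhds (by simp)).1 hf
  obtain ⟨v, hvu, hv, hpv⟩ := mem_nhds_iff.1 hu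
  have h1 := (hfu.mono hvu).contMDiffOn_tangentMapWithin (m := ω) (by simp) hv.uniqueMDiffOn
  have h2 : ContMDiffAt I 𝓘(ℂ, F).tangent ω
      (fun q => tangentMapWithin I 𝓘(ℂ, F) f v (⟨q, V q⟩ : TangentBundle I M)) p := by
    refine ContMDiffAt.comp p (h1.contMDiffAt ?_) hV
    exact (hv.preimage (FiberBundle.continuous_proj B (TangentSpace I))).mem_nhds hpv
  have h3 := (contMDiff_snd_tangentBundle_modelSpace F 𝓘(ℂ, F) (n := ω)).contMDiffAt.comp p h2
  refine h3.congr_of_eventuallyEq ?_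
  filter_upwards [hv.mem_nhds hpv] with q hq
  simp only [fieldDeriv, Function.comp, tangentMapWithin]
  rw [mfderivWithin_of_isOpen hv hq]

section IterateDeriv

variable {V W : ∀ p : M, TangentSpace I p} {p : M}

lemma iterate_fieldDeriv_congr {f g : M → F} (hfg : f =ᶠ[𝓝 p] g) (j : ℕ) :
    (fieldDeriv I V)^[j] f =ᶠ[𝓝 p] (fieldDeriv I V)^[j] g := by
  induction j with
  | zero => exact hfg
  | succ j ih =>
    simp only [Function.iterate_succ_apply']
    filter_upwards [ih.eventuallyEq_nhds] with q hq
    exact fieldDeriv_congr rfl hq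

lemma contMDiffAt_iterate_fieldDeriv [IsManifold I ω M]
    (hV : ContMDiffAt I I.tangent ω (fun q => (⟨q, V q⟩ : TangentBundle I M)) p)
    {f : M → F} (hf : ContMDiffAt I 𝓘(ℂ, F) ω f p) (j : ℕ) :
    ContMDiffAt I 𝓘(ℂ, F) ω ((fieldDeriv I V)^[j] f) p := by
  induction j with
  | zero => exact hf
  | succ j ih =>
    rw [Function.iterate_succ_apply']
    exact contMDiffAt_fieldDeriv hV ih

lemma eventually_mdifferentiableAt [IsManifold I ω M] {f : M → F}
    (hf : ContMDiffAt I 𝓘(ℂ, F) ω f p) : ∀ᶠ q in 𝓝 p, MDifferentiableAt I 𝓘(ℂ, F) f q :=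
  ((contMDiffAt_iff_contMDiffAt_nhds (by simp)).1 hf).mono fun _ h =>
    h.mdifferentiableAt (by simp)

lemma iterate_fieldDeriv_add [IsManifold I ω M]
    (hV : ContMDiffAt I I.tangent ω (fun q => (⟨q, V q⟩ : TangentBundle I M)) p)
    {f g : M → F} (hf : ContMDiffAt I 𝓘(ℂ, F) ω f p) (hg : ContMDiffAt I 𝓘(ℂ, F) ω g p) (j : ℕ) :
    (fieldDeriv I V)^[j] (f + g) =ᶠ[𝓝 p] (fieldDeriv I V)^[j] f + (fieldDeriv I V)^[j] g := by
  induction j with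
  | zero => rfl
  | succ j ih =>
    simp only [Function.iterate_succ_apply']
    filter_upwards [ih.eventuallyEq_nhds,
      eventually_mdifferentiableAt (contMDiffAt_iterate_fieldDeriv hV hf j),
      eventually_mdifferentiableAt (contMDiffAt_iterate_fieldDeriv hV hg j)] with q hq h1 h2
    rw [fieldDeriv_congr rfl hq, fieldDeriv_add h1 h2, Pi.add_apply]

end IterateDeriv

variable [I.Boundaryless]

variable (I) in
/-- The coordinate expression of the vector field `V` in the chart at `x`. -/
def chartField (x : M) (V : ∀ p : M, TangentSpace I p) : B → B :=
  mpullbackWithin 𝓘(ℂ, B) I (extChartAt I x).symm V (Set.range I)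

/-- In the chart at `x`, the derivative of `g` along `V` is the derivative of the coordinate
expression of `g` along the coordinate expression of `V`. -/
lemma fieldDeriv_eq_fderiv [IsManifold I ω M] (x : M) {V : ∀ p : M, TangentSpace I p} {g : M → F}
    {e : B} (he : e ∈ (extChartAt I x).target)
    (hg : MDifferentiableAt I 𝓘(ℂ, F) g ((extChartAt I x).symm e)) :
    fderiv ℂ (g ∘ (extChartAt I x).symm) e (chartField I x V e) =
    fieldDeriv I V g ((extChartAt I x).symm e) := by
  have hr : Set.range I = Set.univ := I.range_eq_univ
  have hs : MDifferentiableAt 𝓘(ℂ, B) I (extChartAt I x).symm e := by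
    have := mdifferentiableWithinAt_extChartAt_symm (I := I) he
    rwa [hr, mdifferentiableWithinAt_univ] at this
  have hinv := isInvertible_mfderivWithin_extChartAt_symm (I := I) he
  have hc := mfderiv_comp e hg hs
  have h2 : mfderiv 𝓘(ℂ, B) I (extChartAt I x).symm e
      (mpullbackWithin 𝓘(ℂ, B) I (extChartAt I x).symm V (Set.range I) e)
      = V ((extChartAt I x).symm e) := by
    rw [hr, mfderivWithin_univ] at hinv
    rw [hr, mpullbackWithin_apply, mfderivWithin_univ]
    exact hinv.self_apply_inverse _
  rw [← mfderiv_eq_fderiv, hc]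
  exact congrArg (mfderiv I 𝓘(ℂ, F) g ((extChartAt I x).symm e)) h2

lemma chartField_mlieBracket_self [IsManifold I ω M] [CompleteSpace B] (x : M)
    (V W : ∀ p : M, TangentSpace I p) :
    chartField I x (mlieBracket I V W) (extChartAt I x x) =
      lieBracket ℂ (chartField I x V) (chartField I x W) (extChartAt I x x) := by
  have hr : Set.range I = Set.univ := I.range_eq_univ
  have hxt : extChartAt I x x ∈ (extChartAt I x).target := mem_extChartAt_target x
  have hcongr : ∀ y : M, y = x → (mlieBracket I V W y : B) = (mlieBracket I V W x : B) := by
    rintro y rfl; rfl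
  let A : B →L[ℂ] B :=
    mfderivWithin 𝓘(ℂ, B) I (extChartAt I x).symm (Set.range I) (extChartAt I x x)
  let C : B →L[ℂ] B := mfderiv I 𝓘(ℂ, B) (extChartAt I x) x
  have hA : A.IsInvertible := isInvertible_mfderivWithin_extChartAt_symm (I := I) hxt
  have hC : C.IsInvertible := isInvertible_mfderiv_extChartAt (I := I) (mem_extChartAt_source x)
  have hAC : A.comp C = ContinuousLinearMap.id ℂ B :=
    mfderivWithin_extChartAt_symm_comp_mfderiv_extChartAt' (I := I) (mem_extChartAt_source x)
  have hdef : (mlieBracket I V W x : B) = C.inverse (lieBracketWithin ℂ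
      (chartField I x V) (chartField I x W) ((extChartAt I x).symm ⁻¹' Set.univ ∩ Set.range I)
        (extChartAt I x x)) := rfl
  rw [Set.preimage_univ, Set.univ_inter, hr, lieBracketWithin_univ] at hdef
  change A.inverse (mlieBracket I V W ((extChartAt I x).symm (extChartAt I x x)) : B) = _
  rw [hcongr _ (extChartAt_to_inv x), hdef]
  generalize lieBracket ℂ (chartField I x V) (chartField I x W) (extChartAt I x x) = Z
  have hZ : A (C (C.inverse Z)) = C.inverse Z := congrArg (fun L : B →L[ℂ] B => L (C.inverse Z)) hAC
  rw [hC.self_apply_inverse] at hZ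
  rw [← hZ, hA.inverse_apply_self]

/-- The derivative along `[V, W]` is the commutator of the derivatives along `V` and `W`. -/
theorem fieldDeriv_mlieBracket [IsManifold I ω M] [CompleteSpace B]
    {V W : ∀ p : M, TangentSpace I p} {f : M → F} {x : M}
    (hV : ContMDiffAt I I.tangent ω (fun q => (⟨q, V q⟩ : TangentBundle I M)) x)
    (hW : ContMDiffAt I I.tangent ω (fun q => (⟨q, W q⟩ : TangentBundle I M)) x)
    (hf : ContMDiffAt I 𝓘(ℂ, F) ω f x) :
    fieldDeriv I (mlieBracket I V W) f x =
      fieldDeriv I V (fieldDeriv I W f) x - fieldDeriv I W (fieldDeriv I V f) x := by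
  have hr : Set.range I = Set.univ := I.range_eq_univ
  set φ := extChartAt I x with hφ
  have hx : φ.symm (φ x) = x := extChartAt_to_inv x
  have hxt : φ x ∈ φ.target := mem_extChartAt_target x
  have hsymm : ContMDiffAt 𝓘(ℂ, B) I ω φ.symm (φ x) := by
    have := contMDiffWithinAt_extChartAt_symm_range (I := I) (n := ω) x hxt
    rwa [hr, contMDiffWithinAt_univ] at this
  have hdiff : ∀ {U : ∀ p : M, TangentSpace I p},
      ContMDiffAt I I.tangent ω (fun q => (⟨q, U q⟩ : TangentBundle I M)) x →
      DifferentiableAt ℂ (chartField I x U) (φ x) := by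
    intro U hU
    have := (hU.mdifferentiableAt (by simp)).mdifferentiableWithinAt
      (s := Set.univ) |>.differentiableWithinAt_mpullbackWithin_vectorField
    rw [Set.preimage_univ, Set.univ_inter] at this
    exact this.differentiableAt (by rw [hr]; exact Filter.univ_mem)
  have hmd : ∀ {U : ∀ p : M, TangentSpace I p},
      ContMDiffAt I I.tangent ω (fun q => (⟨q, U q⟩ : TangentBundle I M)) x →
      MDifferentiableAt I 𝓘(ℂ, F) (fieldDeriv I U f) x := fun hU =>
    (contMDiffAt_fieldDeriv hU hf).mdifferentiableAt (by simp)
  have hev : ∀ U : ∀ p : M, TangentSpace I p,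
      (fun e => fderiv ℂ (f ∘ φ.symm) e (chartField I x U e)) =ᶠ[𝓝 (φ x)]
      fieldDeriv I U f ∘ φ.symm := by
    intro U
    have h1 : ∀ᶠ y in 𝓝 x, ContMDiffAt I 𝓘(ℂ, F) ω f y :=
      (contMDiffAt_iff_contMDiffAt_nhds (by simp)).1 hf
    have h2 : Tendsto φ.symm (𝓝 (φ x)) (𝓝 x) := by
      have := hsymm.continuousAt
      rwa [ContinuousAt, hx] at this
    filter_upwards [h2.eventually h1, extChartAt_target_mem_nhds x] with e he het
    exact fieldDeriv_eq_fderiv x het (he.mdifferentiableAt (by simp))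
  have hfd : ContDiffAt ℂ ω (f ∘ φ.symm) (φ x) := by
    rw [← contMDiffAt_iff_contDiffAt]
    exact ContMDiffAt.comp (φ x) (by rwa [hx]) hsymm
  have key := fderiv_apply_lieBracket hfd (by simp [minSmoothness_of_isRCLikeNormedField])
    (hdiff hW) (hdiff hV)
  rw [(hev W).fderiv_eq, (hev V).fderiv_eq] at key
  rw [← chartField_mlieBracket_self, fieldDeriv_eq_fderiv x hxt, fieldDeriv_eq_fderiv x hxt,
    fieldDeriv_eq_fderiv x hxt, hx] at key
  · exact key
  · rw [hx]; exact hmd hV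
  · rw [hx]; exact hmd hW
  · rw [hx]; exact hf.mdifferentiableAt (by simp)

section Iterate

variable {V W : ∀ p : M, TangentSpace I p} {p : M}

/-- If the iterated brackets `C i` vanish at `p` for `i` from `l` to `l + j - 1`, then in the
expansion of `V^j (C l f)` at `p` only the term with `j` derivatives on `C l` survives. -/
lemma iterate_fieldDeriv_apply_of_eq_zero [IsManifold I ω M] [CompleteSpace B]
    {C : ℕ → ∀ p : M, TangentSpace I p}
    (hV : ContMDiffAt I I.tangent ω (fun q => (⟨q, V q⟩ : TangentBundle I M)) p)
    (hC : ∀ i, ContMDiffAt I I.tangent ω (fun q => (⟨q, C i q⟩ : TangentBundle I M)) p)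
    (hsucc : ∀ i, C (i + 1) = mlieBracket I V (C i)) (j : ℕ) :
    ∀ (l : ℕ) (f : M → F), ContMDiffAt I 𝓘(ℂ, F) ω f p → (∀ i < j, C (l + i) p = 0) →
      (fieldDeriv I V)^[j] (fieldDeriv I (C l) f) p = fieldDeriv I (C (l + j)) f p := by
  induction j with
  | zero => intro l f _ _; rfl
  | succ j ih =>
    intro l f hf h0
    have hev : fieldDeriv I V (fieldDeriv I (C l) f) =ᶠ[𝓝 p]
        fieldDeriv I (C (l + 1)) f + fieldDeriv I (C l) (fieldDeriv I V f) := by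
      filter_upwards [(contMDiffAt_iff_contMDiffAt_nhds (by simp)).1 hf,
        (contMDiffAt_iff_contMDiffAt_nhds (by simp)).1 hV,
        (contMDiffAt_iff_contMDiffAt_nhds (by simp)).1 (hC l)] with q h1 h2 h3
      rw [hsucc, Pi.add_apply, fieldDeriv_mlieBracket h2 h3 h1, sub_add_cancel]
    have hVf := contMDiffAt_fieldDeriv hV hf
    rw [Function.iterate_succ_apply, (iterate_fieldDeriv_congr hev j).eq_of_nhds,
      (iterate_fieldDeriv_add hV (contMDiffAt_fieldDeriv (hC _) hf)
        (contMDiffAt_fieldDeriv (hC _) hVf) j).eq_of_nhds, Pi.add_apply,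
      ih (l + 1) f hf (fun i hi => by
        rw [Nat.add_right_comm]; exact h0 (i + 1) (by omega)),
      ih l _ hVf fun i hi => h0 i (by omega)]
    have : fieldDeriv I (C (l + j)) (fieldDeriv I V f) p = 0 :=
      fieldDeriv_eq_zero (h0 j (by omega))
    rw [this, add_zero, Nat.add_right_comm, Nat.add_assoc]

/-- If the iterated brackets `[V, [V, …, W - V]]` with fewer than `k` entries `V` vanish at `p`,
then `W^(k+1) - V^(k+1)` acts at `p` as the tangent vector given by the bracket with `k`
entries `V`. -/
theorem iterate_succ_fieldDeriv_eq_add [IsManifold I ω M] [CompleteSpace B]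
    {C : ℕ → ∀ p : M, TangentSpace I p}
    (hV : ContMDiffAt I I.tangent ω (fun q => (⟨q, V q⟩ : TangentBundle I M)) p)
    (hW : ContMDiffAt I I.tangent ω (fun q => (⟨q, W q⟩ : TangentBundle I M)) p)
    (hC : ∀ i, ContMDiffAt I I.tangent ω (fun q => (⟨q, C i q⟩ : TangentBundle I M)) p)
    (hzero : ∀ q, C 0 q = W q - V q) (hsucc : ∀ i, C (i + 1) = mlieBracket I V (C i)) (k : ℕ) :
    (∀ i < k, C i p = 0) → ∀ f : M → F, ContMDiffAt I 𝓘(ℂ, F) ω f p →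
      (fieldDeriv I W)^[k + 1] f p =
        (fieldDeriv I V)^[k + 1] f p + fieldDeriv I (C k) f p := by
  -- `W = V + C 0`, so `W^(k+2) f = W^(k+1) (W f) = V^(k+1) (W f)` at `p` by induction, and the
  -- term `V^(k+1) (C 0 f)` is reduced to a single bracket.
  have hC0 : ∀ f : M → F, fieldDeriv I W f = fieldDeriv I V f + fieldDeriv I (C 0) f := by
    intro f
    funext q
    have : C 0 q = (W - V) q := hzero q
    rw [Pi.add_apply, fieldDeriv_congr this EventuallyEq.rfl, fieldDeriv_sub_left]
    abel
  induction k with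
  | zero => intro _ f _; exact congrFun (hC0 f) p
  | succ k ih =>
    intro h0 f hf
    have hk := ih (fun i hi => h0 i (by omega)) _ (contMDiffAt_fieldDeriv hW hf)
    have hz : fieldDeriv I (C k) (fieldDeriv I W f) p = 0 :=
      fieldDeriv_eq_zero (h0 k (by omega))
    rw [hz, add_zero] at hk
    rw [Function.iterate_succ_apply, hk, hC0,
      (iterate_fieldDeriv_add hV (contMDiffAt_fieldDeriv hV hf)
        (contMDiffAt_fieldDeriv (hC 0) hf) (k + 1)).eq_of_nhds, Pi.add_apply,
      iterate_fieldDeriv_apply_of_eq_zero hV hC hsucc (k + 1) 0 f hf fun i hi => by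
        simpa using h0 i hi, ← Function.iterate_succ_apply, Nat.zero_add]

end Iterate

end FieldDeriv

/-! ### Holomorphic ordinary differential equations -/

section ComplexODE

open Metric

variable {B : Type*} [NormedAddCommGroup B] [NormedSpace ℂ B] [CompleteSpace B]

/-- Cauchy's existence theorem for ordinary differential equations in a complex time variable:
`u' = v (t, u)` has a holomorphic local solution with prescribed initial value. -/
theorem exists_eventually_hasDerivAt {v : ℂ × B → B} {x₀ : B} (hv : ContDiffAt ℂ 1 v (0, x₀)) :
    ∃ u : ℂ → B, u 0 = x₀ ∧ ∀ᶠ t in 𝓝 (0 : ℂ), HasDerivAt u (v (t, u t)) t := by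
  -- a ball on which `v` is differentiable, Lipschitz and bounded
  obtain ⟨K, s, hs, hK⟩ := hv.exists_lipschitzOnWith
  have hd : ∀ᶠ p in 𝓝 ((0 : ℂ), x₀), DifferentiableAt ℂ v p :=
    (hv.eventually (by simp)).mono fun p hp => hp.differentiableAt one_ne_zero
  have hb : ∀ᶠ p in 𝓝 ((0 : ℂ), x₀), ‖v p‖ ≤ ‖v (0, x₀)‖ + 1 :=
    (hv.continuousAt.norm.eventually_lt continuousAt_const (lt_add_one _)).mono fun _ h => h.le
  obtain ⟨a, ha, hball⟩ := Metric.eventually_nhds_iff_ball.1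
    ((eventually_mem_set.2 hs).and (hd.and hb))
  set M : ℝ := ‖v (0, x₀)‖ + 1 with hM
  have hM0 : 0 < M := by positivity
  have hK0 : (0 : ℝ) < K + 1 := by positivity
  obtain ⟨r, hr0, hra, hrM, hrK⟩ : ∃ r : ℝ, 0 < r ∧ r ≤ a ∧ M * r ≤ a / 2 ∧ K * r ≤ 1 / 2 := by
    refine ⟨min a (min (a / 2 / M) (1 / 2 / (K + 1))), by positivity, min_le_left _ _, ?_, ?_⟩
    · calc M * _ ≤ M * (a / 2 / M) := by
            gcongr; exact (min_le_right _ _).trans (min_le_left _ _)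
        _ = a / 2 := by field_simp
    · calc (K : ℝ) * _ ≤ (K + 1) * (1 / 2 / (K + 1)) := by
            gcongr
            · exact le_add_of_nonneg_right zero_le_one
            · exact (min_le_right _ _).trans (min_le_right _ _)
        _ = 1 / 2 := by field_simp
  set D : Set ℂ := ball 0 r with hD
  have h0D : (0 : ℂ) ∈ D := mem_ball_self hr0
  have hDopen : IsOpen D := isOpen_ball
  have hDconv : Convex ℝ D := convex_ball _ _
  let P : (ℂ → B) → Prop := fun u =>
    DifferentiableOn ℂ u D ∧ u 0 = x₀ ∧ ∀ t ∈ D, dist (u t) x₀ ≤ a / 2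
  have hmem : ∀ u, P u → ∀ t ∈ D, (t, u t) ∈ ball ((0 : ℂ), x₀) a := by
    intro u hu t ht
    rw [mem_ball, Prod.dist_eq]
    exact max_lt (lt_of_lt_of_le ht hra) ((hu.2.2 t ht).trans_lt (half_lt_self ha))
  -- the iteration `u ↦ T u` of Picard, where `T u` is a primitive of `t ↦ v (t, u t)` on the disc
  have step : ∀ u : {u // P u}, ∃ w : {u // P u}, ∀ t ∈ D, HasDerivAt w.1 (v (t, u.1 t)) t := by
    rintro ⟨u, hu⟩
    have hdv : DifferentiableOn ℂ (fun t => v (t, u t)) D := by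
      intro t ht
      have h1 := (hball _ (hmem u hu t ht)).2.1
      have h2 : DifferentiableAt ℂ (fun t => (t, u t)) t :=
        differentiableAt_id.prodMk ((hu.1 t ht).differentiableAt (hDopen.mem_nhds ht))
      exact (h1.comp t h2).differentiableWithinAt
    obtain ⟨w, hw0, hw⟩ := hdv.isExactOn_ball.with_val_at 0 x₀
    refine ⟨⟨w, fun t ht => (hw t ht).differentiableAt.differentiableWithinAt, hw0,
      fun t ht => ?_⟩, hw⟩
    have := hDconv.norm_image_sub_le_of_norm_hasDerivWithin_le
      (fun t ht => (hw t ht).hasDerivWithinAt) (fun t ht => (hball _ (hmem u hu t ht)).2.2) h0D ht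
    rw [hw0, sub_zero] at this
    rw [dist_eq_norm]
    have htr : ‖t‖ ≤ r := (mem_ball_zero_iff.1 ht).le
    calc ‖w t - x₀‖ ≤ M * ‖t‖ := this
      _ ≤ M * r := by gcongr
      _ ≤ a / 2 := hrM
  choose T hT using step
  have hlip : ∀ u w : {u // P u}, ∀ t ∈ D,
      dist (v (t, u.1 t)) (v (t, w.1 t)) ≤ K * dist (u.1 t) (w.1 t) := by
    intro u w t ht
    have := hK.dist_le_mul _ (hball _ (hmem u.1 u.2 t ht)).1 _ (hball _ (hmem w.1 w.2 t ht)).1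
    rwa [Prod.dist_eq, dist_self, max_eq_right dist_nonneg] at this
  have hcontr : ∀ (u w : {u // P u}) (c : ℝ), (∀ t ∈ D, dist (u.1 t) (w.1 t) ≤ c) →
      ∀ t ∈ D, dist ((T u).1 t) ((T w).1 t) ≤ c * (1 / 2) := by
    intro u w c hc t ht
    have hc0 : 0 ≤ c := dist_nonneg.trans (hc 0 h0D)
    have := hDconv.norm_image_sub_le_of_norm_hasDerivWithin_le (C := K * c)
      (fun t ht => ((hT u t ht).sub (hT w t ht)).hasDerivWithinAt)
      (fun t ht => by
        rw [← dist_eq_norm]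
        exact (hlip u w t ht).trans (mul_le_mul_of_nonneg_left (hc t ht) K.2)) h0D ht
    simp only [Pi.sub_apply, (T u).2.2.1, (T w).2.2.1, sub_self, sub_zero] at this
    rw [dist_eq_norm]
    have htr : ‖t‖ ≤ r := (mem_ball_zero_iff.1 ht).le
    calc ‖(T u).1 t - (T w).1 t‖ ≤ K * c * ‖t‖ := this
      _ ≤ K * c * r := by gcongr
      _ = c * (K * r) := by ring
      _ ≤ c * (1 / 2) := by gcongr
  let u₀ : {u // P u} := ⟨fun _ => x₀, differentiableOn_const _, rfl, fun _ _ => by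
    rw [dist_self]; positivity⟩
  let U : ℕ → {u // P u} := fun k => T^[k] u₀
  have hU : ∀ k, U (k + 1) = T (U k) := fun k => Function.iterate_succ_apply' T k u₀
  have hgeom : ∀ k, ∀ t ∈ D, dist ((U k).1 t) ((U (k + 1)).1 t) ≤ a * (1 / 2) ^ k := by
    intro k
    induction k with
    | zero =>
      intro t ht
      rw [dist_comm]
      simpa using! ((U 1).2.2.2 t ht).trans (half_le_self ha.le)
    | succ k ih =>
      intro t ht
      rw [hU (k + 1), hU k, pow_succ, ← mul_assoc]
      exact hcontr _ _ _ (by simpa only [hU] using ih) t ht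
  have hlim : ∀ t, ∃ l, t ∈ D → Tendsto (fun k => (U k).1 t) atTop (𝓝 l) := by
    intro t
    by_cases ht : t ∈ D
    · obtain ⟨l, hl⟩ := cauchySeq_tendsto_of_complete
        (cauchySeq_of_le_geometric (1 / 2) a (by norm_num) fun k => hgeom k t ht)
      exact ⟨l, fun _ => hl⟩
    · exact ⟨0, fun h => absurd h ht⟩
  choose u hu using hlim
  have hdist : ∀ k, ∀ t ∈ D, dist ((U k).1 t) (u t) ≤ a * (1 / 2) ^ k / (1 - 1 / 2) := fun k t ht =>
    dist_le_of_le_geometric_of_tendsto (1 / 2) a (by norm_num) (fun k => hgeom k t ht) (hu t ht) k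
  have hmemu : ∀ t ∈ D, (t, u t) ∈ ball ((0 : ℂ), x₀) a := by
    intro t ht
    rw [mem_ball, Prod.dist_eq]
    exact max_lt (lt_of_lt_of_le ht hra) ((le_of_tendsto' ((hu t ht).dist tendsto_const_nhds)
      fun k => (U k).2.2.2 t ht).trans_lt (half_lt_self ha))
  have hunif : TendstoUniformlyOn (fun k t => v (t, (U k).1 t)) (fun t => v (t, u t)) atTop D := by
    rw [Metric.tendstoUniformlyOn_iff]
    intro ε hε
    have hgeo : Tendsto (fun k : ℕ => (K : ℝ) * (a * (1 / 2) ^ k / (1 - 1 / 2))) atTop (𝓝 0) := by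
      have := tendsto_pow_atTop_nhds_zero_of_lt_one (r := (1 / 2 : ℝ)) (by norm_num) (by norm_num)
      simpa using ((this.const_mul a).div_const (1 - 1 / 2)).const_mul (K : ℝ)
    filter_upwards [hgeo.eventually_lt_const hε] with k hk t ht
    refine lt_of_le_of_lt ?_ hk
    have := hK.dist_le_mul _ (hball _ (hmem _ (U k).2 t ht)).1 _ (hball _ (hmemu t ht)).1
    rw [Prod.dist_eq, dist_self, max_eq_right dist_nonneg] at this
    rw [dist_comm]
    exact this.trans (mul_le_mul_of_nonneg_left (hdist k t ht) K.2)
  refine ⟨u, ?_, ?_⟩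
  · refine tendsto_nhds_unique (hu 0 h0D) ?_
    simp only [(U _).2.2.1]
    exact tendsto_const_nhds
  · filter_upwards [hDopen.mem_nhds h0D] with t ht
    refine hasDerivAt_of_tendstoUniformlyOn hDopen hunif (f := fun k => (U (k + 1)).1)
      (.of_forall fun k t ht => ?_) (fun t ht => (tendsto_add_atTop_iff_nat 1).2 (hu t ht)) ht
    rw [hU]
    exact hT (U k) t ht

end ComplexODE

/-! ### The Lie algebra of sections of a bracket-closed sheaf -/

section SectionAlgebra

variable {E X : Type u} [NormedAddCommGroup E] [NormedSpace ℂ E]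
  [TopologicalSpace X] [ChartedSpace E X]

lemma extendZero_apply {U : Opens X} (A : ∀ x : U, TangentSpace 𝓘(ℂ, E) (x : X)) {x : X}
    (hx : x ∈ U) : extendZero A x = A ⟨x, hx⟩ := dif_pos hx

lemma extendZero_add {U : Opens X} (A B : ∀ x : U, TangentSpace 𝓘(ℂ, E) (x : X)) :
    extendZero (A + B) = extendZero A + extendZero B := by
  funext x
  by_cases hx : x ∈ U
  · simp only [Pi.add_apply, extendZero_apply _ hx]
  · simp only [extendZero, Pi.add_apply, dif_neg hx, add_zero]

lemma extendZero_smul {U : Opens X} (c : ℂ) (A : ∀ x : U, TangentSpace 𝓘(ℂ, E) (x : X)) :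
    extendZero (c • A) = c • extendZero A := by
  funext x
  by_cases hx : x ∈ U
  · simp only [Pi.smul_apply, extendZero_apply _ hx]
  · simp only [extendZero, Pi.smul_apply, dif_neg hx, smul_zero]

lemma extendZero_lieBracketOn {U : Opens X} (A B : ∀ x : U, TangentSpace 𝓘(ℂ, E) (x : X)) {x : X}
    (hx : x ∈ U) : extendZero (lieBracketOn A B) =ᶠ[𝓝 x]
      mlieBracket 𝓘(ℂ, E) (extendZero A) (extendZero B) := by
  filter_upwards [U.isOpen.mem_nhds hx] with y hy
  rw [extendZero_apply _ hy]
  rfl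

variable [IsManifold 𝓘(ℂ, E) ω X]

/-- The sections over `U` of a bracket-closed subsheaf of the tangent sheaf, as a Lie algebra. The
proof of closedness is a parameter so that the bracket can be an instance. -/
def VectorFieldSheaf.LieSections (F : VectorFieldSheaf E X) (_hF : F.LieClosed) (U : Opens X) :
    Type u := F.sec U

variable {F : VectorFieldSheaf E X} {hF : F.LieClosed} {U : Opens X}

instance : AddCommGroup (F.LieSections hF U) := inferInstanceAs (AddCommGroup (F.sec U))

instance : Module ℂ (F.LieSections hF U) := inferInstanceAs (Module ℂ (F.sec U))

/-- The inclusion of the sections of `F` into all (set-theoretic) vector fields on `U`. -/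
def VectorFieldSheaf.LieSections.val :
    F.LieSections hF U →ₗ[ℂ] ∀ x : U, TangentSpace 𝓘(ℂ, E) (x : X) := (F.sec U).subtype

lemma LieSections.ext {A B : F.LieSections hF U} (h : ∀ x, A.val x = B.val x) : A = B :=
  Subtype.ext (funext h)

lemma LieSections.val_mem (A : F.LieSections hF U) : A.val ∈ F.sec U := A.2

lemma LieSections.contMDiffAt (A : F.LieSections hF U) {x : X} (hx : x ∈ U) :
    ContMDiffAt 𝓘(ℂ, E) (𝓘(ℂ, E)).tangent ω
      (fun y : X => (⟨y, extendZero A.val y⟩ : TangentBundle 𝓘(ℂ, E) X)) x :=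
  (F.holomorphic U A.val A.2).contMDiffAt (U.isOpen.mem_nhds hx)

lemma LieSections.mdifferentiableAt (A : F.LieSections hF U) {x : X} (hx : x ∈ U) :
    MDifferentiableAt 𝓘(ℂ, E) (𝓘(ℂ, E)).tangent
      (fun y : X => (⟨y, extendZero A.val y⟩ : TangentBundle 𝓘(ℂ, E) X)) x :=
  (LieSections.contMDiffAt A hx).mdifferentiableAt (by simp)

instance : Bracket (F.LieSections hF U) (F.LieSections hF U) :=
  ⟨fun A B => ⟨lieBracketOn A.val B.val, hF U _ A.2 _ B.2⟩⟩

lemma LieSections.val_lie (A B : F.LieSections hF U) : ⁅A, B⁆.val = lieBracketOn A.val B.val := rfl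

lemma LieSections.lie_swap (A B : F.LieSections hF U) : ⁅A, B⁆ = -⁅B, A⁆ := by
  refine LieSections.ext fun x => ?_
  rw [map_neg, Pi.neg_apply]
  exact mlieBracket_swap_apply

variable [CompleteSpace E]

lemma LieSections.add_lie (A B C : F.LieSections hF U) : ⁅A + B, C⁆ = ⁅A, C⁆ + ⁅B, C⁆ := by
  refine LieSections.ext fun x => ?_
  rw [map_add, Pi.add_apply, LieSections.val_lie, LieSections.val_lie, LieSections.val_lie, map_add]
  unfold lieBracketOn
  rw [extendZero_add, mlieBracket_add_left (LieSections.mdifferentiableAt A x.2)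
    (LieSections.mdifferentiableAt B x.2)]

lemma LieSections.leibniz (A B C : F.LieSections hF U) :
    ⁅A, ⁅B, C⁆⁆ = ⁅⁅A, B⁆, C⁆ + ⁅B, ⁅A, C⁆⁆ := by
  refine LieSections.ext fun x => ?_
  have h2 : minSmoothness ℂ 2 ≤ ω := by simp
  have h := leibniz_identity_mlieBracket_apply ((LieSections.contMDiffAt A x.2).of_le h2)
    ((LieSections.contMDiffAt B x.2).of_le h2) ((LieSections.contMDiffAt C x.2).of_le h2)
  rw [map_add, Pi.add_apply]
  refine ((EventuallyEq.refl _ _).mlieBracket_vectorField_eq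
    (extendZero_lieBracketOn _ _ x.2)).trans (h.trans ?_)
  exact congrArg₂ (· + ·)
    ((extendZero_lieBracketOn _ _ x.2).mlieBracket_vectorField_eq (EventuallyEq.refl _ _)).symm
    ((EventuallyEq.refl _ _).mlieBracket_vectorField_eq (extendZero_lieBracketOn _ _ x.2)).symm

instance : LieRing (F.LieSections hF U) where
  add_lie := LieSections.add_lie
  lie_add A B C := by
    rw [LieSections.lie_swap, LieSections.add_lie, LieSections.lie_swap B, LieSections.lie_swap C]
    abel
  lie_self A := by
    have h : (2 : ℂ) • ⁅A, A⁆ = 0 := by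
      rw [two_smul]
      exact eq_neg_iff_add_eq_zero.1 (LieSections.lie_swap A A)
    exact (smul_eq_zero.1 h).resolve_left two_ne_zero
  leibniz_lie := LieSections.leibniz

instance : LieAlgebra ℂ (F.LieSections hF U) where
  lie_smul c A B := by
    refine LieSections.ext fun x => ?_
    rw [map_smul, Pi.smul_apply, LieSections.val_lie, LieSections.val_lie, map_smul]
    unfold lieBracketOn
    rw [extendZero_smul, mlieBracket_const_smul_right (LieSections.mdifferentiableAt B x.2)]

end SectionAlgebra

/-! ### Time-dependent vector fields as polynomials in time -/

section ProductFields

variable {E X : Type u} [NormedAddCommGroup E] [NormedSpace ℂ E]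
  [TopologicalSpace X] [ChartedSpace E X]

lemma contMDiffAt_polynomial_eval_snd (q : ℂ[X]) (p : X × ℂ) :
    ContMDiffAt (𝓘(ℂ, E).prod 𝓘(ℂ)) 𝓘(ℂ) ω (fun p : X × ℂ => q.eval p.2) p := by
  have : ContDiff ℂ ω (fun t : ℂ => q.eval t) := by
    simpa using q.contDiff_aeval (𝕜 := ℂ) ω
  exact this.contMDiff.contMDiffAt.comp p contMDiffAt_snd

lemma fieldDeriv_eq_add {B : Type*} [NormedAddCommGroup B] [NormedSpace ℂ B]
    {V : ∀ p : X × ℂ, TangentSpace (𝓘(ℂ, E).prod 𝓘(ℂ)) p} {f : X × ℂ → B} {p : X × ℂ}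
    (hf : MDifferentiableAt (𝓘(ℂ, E).prod 𝓘(ℂ)) 𝓘(ℂ, B) f p)
    {w : ∀ x : X, TangentSpace 𝓘(ℂ, E) x} {c : ℂ} (hV : V p = (w p.1, c)) :
    fieldDeriv (𝓘(ℂ, E).prod 𝓘(ℂ)) V f p =
      fieldDeriv 𝓘(ℂ, E) w (fun x => f (x, p.2)) p.1 + c • deriv (fun t => f (p.1, t)) p.2 := by
  unfold fieldDeriv
  rw [mfderiv_prod_eq_add_apply hf, hV]
  refine congrArg₂ (fun a b : B => a + b) rfl ?_
  change (mfderiv 𝓘(ℂ) 𝓘(ℂ, B) (fun t => f (p.1, t)) p.2 : ℂ →L[ℂ] B) c = _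
  rw [mfderiv_eq_fderiv, ← fderiv_eq_smul_deriv]
  rfl

lemma fieldDeriv_comp_fst {B : Type*} [NormedAddCommGroup B] [NormedSpace ℂ B]
    {V : ∀ p : X × ℂ, TangentSpace (𝓘(ℂ, E).prod 𝓘(ℂ)) p} {g : X → B} {p : X × ℂ}
    (hg : MDifferentiableAt 𝓘(ℂ, E) 𝓘(ℂ, B) g p.1)
    {w : ∀ x : X, TangentSpace 𝓘(ℂ, E) x} {c : ℂ} (hV : V p = (w p.1, c)) :
    fieldDeriv (𝓘(ℂ, E).prod 𝓘(ℂ)) V (g ∘ Prod.fst) p = fieldDeriv 𝓘(ℂ, E) w g p.1 := by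
  rw [fieldDeriv_eq_add (hg.comp p mdifferentiableAt_fst) hV]
  change _ + c • deriv (fun _ : ℂ => g p.1) p.2 = _
  rw [deriv_const, smul_zero, add_zero]
  rfl

variable [IsManifold 𝓘(ℂ, E) ω X]

lemma contMDiffAt_prodField {w : ∀ x : X, TangentSpace 𝓘(ℂ, E) x} (c : ℂ) {p : X × ℂ}
    (hw : ContMDiffAt 𝓘(ℂ, E) (𝓘(ℂ, E)).tangent ω
      (fun y : X => (⟨y, w y⟩ : TangentBundle 𝓘(ℂ, E) X)) p.1) :
    ContMDiffAt (𝓘(ℂ, E).prod 𝓘(ℂ)) (𝓘(ℂ, E).prod 𝓘(ℂ)).tangent ω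
      (fun q : X × ℂ => (⟨q, (w q.1, c)⟩ :
        TangentBundle (𝓘(ℂ, E).prod 𝓘(ℂ)) (X × ℂ))) p := by
  have h := contMDiff_equivTangentBundleProd_symm (I := 𝓘(ℂ, E)) (M := X) (I' := 𝓘(ℂ)) (M' := ℂ)
    (n := ω)
  have h1 := ContMDiffAt.comp p hw (contMDiffAt_fst (I := 𝓘(ℂ, E)) (J := 𝓘(ℂ)))
  have h2 : ContMDiffAt 𝓘(ℂ) 𝓘(ℂ).tangent ω (fun t : ℂ => (⟨t, c⟩ : TangentBundle 𝓘(ℂ) ℂ)) p.2 :=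
    contMDiffAt_vectorSpace_iff_contDiffAt.2 contDiffAt_const
  exact h.contMDiffAt.comp p (h1.prodMk (ContMDiffAt.comp p h2
    (contMDiffAt_snd (I := 𝓘(ℂ, E)) (J := 𝓘(ℂ)))))

/-- Coordinate functions separate tangent vectors. -/
lemma mfderiv_extChartAt_injective (x : X) :
    Function.Injective (mfderiv 𝓘(ℂ, E) 𝓘(ℂ, E) (extChartAt 𝓘(ℂ, E) x) x : E → E) :=
  (isInvertible_mfderiv_extChartAt (I := 𝓘(ℂ, E)) (mem_extChartAt_source x)).injective

/-- A tangent vector of `X × ℂ` is determined by its action on functions of the first variable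
and on the time coordinate. -/
lemma tangentVector_prod_ext {V W : ∀ p : X × ℂ, TangentSpace (𝓘(ℂ, E).prod 𝓘(ℂ)) p} {p : X × ℂ}
    (hfst : ∀ g : X → E, ContMDiffAt 𝓘(ℂ, E) 𝓘(ℂ, E) ω g p.1 →
      fieldDeriv (𝓘(ℂ, E).prod 𝓘(ℂ)) V (g ∘ Prod.fst) p =
        fieldDeriv (𝓘(ℂ, E).prod 𝓘(ℂ)) W (g ∘ Prod.fst) p)
    (hsnd : fieldDeriv (𝓘(ℂ, E).prod 𝓘(ℂ)) V (Prod.snd : X × ℂ → ℂ) p =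
      fieldDeriv (𝓘(ℂ, E).prod 𝓘(ℂ)) W (Prod.snd : X × ℂ → ℂ) p) : V p = W p := by
  have hs : ∀ V : ∀ p : X × ℂ, TangentSpace (𝓘(ℂ, E).prod 𝓘(ℂ)) p,
      fieldDeriv (𝓘(ℂ, E).prod 𝓘(ℂ)) V (Prod.snd : X × ℂ → ℂ) p = (V p : E × ℂ).2 := by
    intro V
    unfold fieldDeriv
    rw [mfderiv_snd]
    rfl
  rw [hs, hs] at hsnd
  refine Prod.ext ?_ hsnd
  have hφ := contMDiffAt_extChartAt (I := 𝓘(ℂ, E)) (n := ω) (x := p.1)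
  have hc : ∀ V : ∀ p : X × ℂ, TangentSpace (𝓘(ℂ, E).prod 𝓘(ℂ)) p,
      fieldDeriv (𝓘(ℂ, E).prod 𝓘(ℂ)) V (extChartAt 𝓘(ℂ, E) p.1 ∘ Prod.fst) p =
        mfderiv 𝓘(ℂ, E) 𝓘(ℂ, E) (extChartAt 𝓘(ℂ, E) p.1) p.1 (V p : E × ℂ).1 := by
    intro V
    exact fieldDeriv_comp_fst (w := fun _ => (V p : E × ℂ).1) (c := (V p : E × ℂ).2)
      (hφ.mdifferentiableAt (by simp)) rfl
  have h := hfst _ hφ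
  rw [hc, hc] at h
  exact mfderiv_extChartAt_injective p.1 h

end ProductFields

section TimeField

variable {E X : Type u} [NormedAddCommGroup E] [NormedSpace ℂ E]
  [TopologicalSpace X] [ChartedSpace E X] [IsManifold 𝓘(ℂ, E) ω X] [CompleteSpace E]
  {F : VectorFieldSheaf E X} {hF : F.LieClosed} {U : Opens X}

/-- The time-dependent vector field on `U` given by a polynomial in `t` with coefficients in
`F(U)`. -/
def timeField (a : CurrentAlgebra (F.LieSections hF U)) :
    ∀ p : U × ℂ, TangentSpace 𝓘(ℂ, E) (p.1 : X) :=
  fun p => (evalTime p.2 a).val p.1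

lemma horizontal_timeField (a : CurrentAlgebra (F.LieSections hF U)) (p : X × ℂ) :
    horizontal (timeField a) p = (extendZero (evalTime p.2 a).val p.1, (0 : ℂ)) := rfl

lemma constantFlow_timeField (a : CurrentAlgebra (F.LieSections hF U)) (p : X × ℂ) :
    constantFlow (timeField a) p = (extendZero (evalTime p.2 a).val p.1, (1 : ℂ)) := rfl

lemma horizontal_timeField_add (a b : CurrentAlgebra (F.LieSections hF U)) :
    horizontal (timeField (a + b)) = horizontal (timeField a) + horizontal (timeField b) := by
  funext p
  rw [Pi.add_apply, horizontal_timeField, map_add, map_add, extendZero_add]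
  exact Prod.ext rfl (add_zero _).symm

lemma horizontal_timeField_monomialTerm (q : ℂ[X]) (A : F.LieSections hF U) :
    horizontal (timeField (monomialTerm q A)) =
      (fun p : X × ℂ => q.eval p.2) • horizontal (timeField (monomialTerm 1 A)) := by
  funext p
  rw [horizontal_timeField, evalTime_tmul, map_smul, extendZero_smul]
  change _ = q.eval p.2 • horizontal (timeField (monomialTerm 1 A)) p
  rw [horizontal_timeField, evalTime_tmul, Polynomial.eval_one, one_smul]
  exact Prod.ext rfl (smul_zero _).symm

lemma contMDiffAt_horizontal (a : CurrentAlgebra (F.LieSections hF U)) {p : X × ℂ}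
    (hp : p.1 ∈ U) :
    ContMDiffAt (𝓘(ℂ, E).prod 𝓘(ℂ)) (𝓘(ℂ, E).prod 𝓘(ℂ)).tangent ω
      (fun q : X × ℂ => (⟨q, horizontal (timeField a) q⟩ :
        TangentBundle (𝓘(ℂ, E).prod 𝓘(ℂ)) (X × ℂ))) p := by
  induction a using CurrentAlgebra.induction with
  | zero =>
    have h := contMDiffAt_prodField 0 (LieSections.contMDiffAt (0 : F.LieSections hF U) hp)
    refine h.congr_of_eventuallyEq (.of_forall fun q => congrArg (fun v : E × ℂ =>
      (⟨q, v⟩ : TangentBundle (𝓘(ℂ, E).prod 𝓘(ℂ)) (X × ℂ))) ?_)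
    rw [horizontal_timeField, map_zero]
    rfl
  | add a b ha hb =>
    rw [horizontal_timeField_add]
    exact ha.add_section hb
  | tmul q A =>
    rw [horizontal_timeField_monomialTerm]
    refine ContMDiffAt.smul_section (contMDiffAt_polynomial_eval_snd q p) ?_
    have h := contMDiffAt_prodField 0 (LieSections.contMDiffAt A hp)
    refine h.congr_of_eventuallyEq (.of_forall fun q => congrArg (fun v : E × ℂ =>
      (⟨q, v⟩ : TangentBundle (𝓘(ℂ, E).prod 𝓘(ℂ)) (X × ℂ))) ?_)
    rw [horizontal_timeField, evalTime_tmul, Polynomial.eval_one, one_smul]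
    rfl

lemma contMDiffAt_constantFlow (a : CurrentAlgebra (F.LieSections hF U)) {p : X × ℂ}
    (hp : p.1 ∈ U) :
    ContMDiffAt (𝓘(ℂ, E).prod 𝓘(ℂ)) (𝓘(ℂ, E).prod 𝓘(ℂ)).tangent ω
      (fun q : X × ℂ => (⟨q, constantFlow (timeField a) q⟩ :
        TangentBundle (𝓘(ℂ, E).prod 𝓘(ℂ)) (X × ℂ))) p := by
  have h0 := contMDiffAt_prodField 1 (LieSections.contMDiffAt (0 : F.LieSections hF U) hp)
  refine ((contMDiffAt_horizontal a hp).add_section h0).congr_of_eventuallyEq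
    (.of_forall fun q => ?_)
  have h00 : extendZero (0 : F.LieSections hF U).val q.1 = (0 : E) := by
    rw [← zero_smul ℂ (0 : F.LieSections hF U), map_smul, extendZero_smul]
    exact zero_smul ℂ _
  have key : ∀ e v : E, v = 0 → e = e + v := fun e v h => by rw [h, add_zero]
  exact congrArg (fun v : E × ℂ => (⟨q, v⟩ : TangentBundle (𝓘(ℂ, E).prod 𝓘(ℂ)) (X × ℂ)))
    (Prod.ext (key _ _ h00) (zero_add (1 : ℂ)).symm)

/-- The linear functional `A ↦ A g (x)` on sections of `F`. -/
def LieSections.derivAt {B : Type*} [NormedAddCommGroup B] [NormedSpace ℂ B] (g : X → B) (x : X) :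
    F.LieSections hF U →ₗ[ℂ] B where
  toFun A := fieldDeriv 𝓘(ℂ, E) (extendZero A.val) g x
  map_add' A B := by
    unfold fieldDeriv
    rw [map_add, extendZero_add]
    exact map_add _ _ _
  map_smul' c A := by
    unfold fieldDeriv
    rw [map_smul, extendZero_smul]
    exact map_smul _ _ _

lemma hasDerivAt_evalTime {B : Type*} [NormedAddCommGroup B] [NormedSpace ℂ B]
    (L : F.LieSections hF U →ₗ[ℂ] B) (v : CurrentAlgebra (F.LieSections hF U)) (t : ℂ) :
    HasDerivAt (fun s => L (evalTime s v)) (L (evalTime t (timeDeriv v))) t := by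
  induction v using CurrentAlgebra.induction with
  | zero => simpa using hasDerivAt_const t (0 : B)
  | add v w hv hw =>
    simp only [map_add]
    exact hv.add hw
  | tmul q A =>
    simp only [timeDeriv_tmul, evalTime_tmul, map_smul]
    exact (q.hasDerivAt t).smul_const (L A)

/-- In coordinates where time is constant along the flow of `∂/∂t + a`, the Lie derivative along
this field is the operator `∂/∂t + [a, -]` on polynomials with coefficients in `F(U)`. -/
theorem mlieBracket_constantFlow_horizontal (a v : CurrentAlgebra (F.LieSections hF U))
    {p : X × ℂ} (hp : p.1 ∈ U) :
    mlieBracket (𝓘(ℂ, E).prod 𝓘(ℂ)) (constantFlow (timeField a)) (horizontal (timeField v)) p =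
      horizontal (timeField (flowDeriv a v)) p := by
  have hA := contMDiffAt_constantFlow a hp
  have hW := contMDiffAt_horizontal v hp
  refine tangentVector_prod_ext (fun g hg => ?_) ?_
  · have hgf : ContMDiffAt (𝓘(ℂ, E).prod 𝓘(ℂ)) 𝓘(ℂ, E) ω (g ∘ Prod.fst) p :=
      ContMDiffAt.comp p hg contMDiffAt_fst
    have hgd : ∀ᶠ q : X × ℂ in 𝓝 p, MDifferentiableAt 𝓘(ℂ, E) 𝓘(ℂ, E) g q.1 :=
      continuous_fst.continuousAt.eventually (eventually_mdifferentiableAt hg)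
    have hΨW : ∀ v : CurrentAlgebra (F.LieSections hF U),
        fieldDeriv (𝓘(ℂ, E).prod 𝓘(ℂ)) (horizontal (timeField v)) (g ∘ Prod.fst) =ᶠ[𝓝 p]
        fun q => LieSections.derivAt g q.1 (evalTime q.2 v) :=
      fun v => hgd.mono fun q hq => fieldDeriv_comp_fst hq (horizontal_timeField v q)
    have hΨA : fieldDeriv (𝓘(ℂ, E).prod 𝓘(ℂ)) (constantFlow (timeField a)) (g ∘ Prod.fst) =ᶠ[𝓝 p]
        fun q => LieSections.derivAt g q.1 (evalTime q.2 a) :=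
      hgd.mono fun q hq => fieldDeriv_comp_fst hq (constantFlow_timeField a q)
    have hdW := ((contMDiffAt_fieldDeriv hW hgf).congr_of_eventuallyEq
      (hΨW v).symm).mdifferentiableAt (by simp)
    have hdA := ((contMDiffAt_fieldDeriv hA hgf).congr_of_eventuallyEq
      hΨA.symm).mdifferentiableAt (by simp)
    rw [fieldDeriv_mlieBracket hA hW hgf, fieldDeriv_congr rfl (hΨW v), fieldDeriv_congr rfl hΨA,
      (hΨW _).eq_of_nhds, fieldDeriv_eq_add hdW (constantFlow_timeField a p),
      fieldDeriv_eq_add hdA (horizontal_timeField v p), zero_smul, one_smul, add_zero,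
      (hasDerivAt_evalTime (LieSections.derivAt g p.1) v p.2).deriv]
    have hbr := fieldDeriv_mlieBracket (LieSections.contMDiffAt (evalTime p.2 a) hp)
      (LieSections.contMDiffAt (evalTime p.2 v) hp) hg
    have hlie : LieSections.derivAt g p.1 (⁅evalTime p.2 a, evalTime p.2 v⁆) =
        fieldDeriv 𝓘(ℂ, E) (mlieBracket 𝓘(ℂ, E) (extendZero (evalTime p.2 a).val)
          (extendZero (evalTime p.2 v).val)) g p.1 :=
      fieldDeriv_congr (extendZero_apply _ hp) EventuallyEq.rfl
    rw [flowDeriv_apply, map_add, map_add, evalTime_lie, hlie, hbr]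
    change _ + _ - _ = _ + (_ - _)
    rw [add_sub_right_comm, add_comm]
    rfl
  · have hs : ContMDiffAt (𝓘(ℂ, E).prod 𝓘(ℂ)) 𝓘(ℂ) ω (Prod.snd : X × ℂ → ℂ) p := contMDiffAt_snd
    have hc : ∀ (c : ℂ) (V W : ∀ p : X × ℂ, TangentSpace (𝓘(ℂ, E).prod 𝓘(ℂ)) p),
        (∀ q, (W q : E × ℂ).2 = c) → fieldDeriv (𝓘(ℂ, E).prod 𝓘(ℂ)) V
          (fieldDeriv (𝓘(ℂ, E).prod 𝓘(ℂ)) W (Prod.snd : X × ℂ → ℂ)) p = 0 := by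
      intro c V W hW
      have : fieldDeriv (𝓘(ℂ, E).prod 𝓘(ℂ)) W (Prod.snd : X × ℂ → ℂ) = fun _ => c := by
        funext q
        unfold fieldDeriv
        rw [mfderiv_snd]
        exact hW q
      rw [this]
      unfold fieldDeriv
      rw [mfderiv_const]
      rfl
    rw [fieldDeriv_mlieBracket hA hW hs, hc 0 _ _ fun _ => rfl, hc 1 _ _ fun _ => rfl, sub_zero]
    unfold fieldDeriv
    rw [mfderiv_snd]
    rfl

lemma iterate_mlieBracket_constantFlow (a v : CurrentAlgebra (F.LieSections hF U)) (m : ℕ)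
    {p : X × ℂ} (hp : p.1 ∈ U) :
    (mlieBracket (𝓘(ℂ, E).prod 𝓘(ℂ)) (constantFlow (timeField a)))^[m]
      (horizontal (timeField v)) p =
      horizontal (timeField ((flowDeriv a)^[m] v)) p := by
  induction m generalizing p with
  | zero => rfl
  | succ m ih =>
    rw [Function.iterate_succ_apply', Function.iterate_succ_apply',
      ← mlieBracket_constantFlow_horizontal a _ hp]
    refine (EventuallyEq.refl (𝓝 p) (constantFlow (timeField a))).mlieBracket_vectorField_eq ?_
    filter_upwards [(U.isOpen.preimage continuous_fst).mem_nhds hp] with q hq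
    exact ih hq

lemma lieIterateAtZero_timeField (a : CurrentAlgebra (F.LieSections hF U)) (m : ℕ) :
    lieIterateAtZero (timeField a) m = (evalTime 0 ((flowDeriv a)^[m] a)).val := by
  funext x
  have h := iterate_mlieBracket_constantFlow a a m (p := ((x : X), (0 : ℂ))) x.2
  exact (congrArg (fun v : E × ℂ => v.1) h).trans
    (extendZero_apply (evalTime 0 ((flowDeriv a)^[m] a)).val x.2)

lemma exists_eq_timeField {A : ∀ p : U × ℂ, TangentSpace 𝓘(ℂ, E) (p.1 : X)}
    (hA : F.IsTimeDependentField A) :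
    ∃ a : CurrentAlgebra (F.LieSections hF U), A = timeField a := by
  obtain ⟨N, a, ha, hAa⟩ := hA
  let b : ℕ → F.LieSections hF U := fun i => ⟨a i, ha i⟩
  refine ⟨∑ i ∈ Finset.range (N + 1), monomialTerm (Polynomial.X ^ i) (b i), ?_⟩
  funext p
  unfold timeField
  rw [map_sum, map_sum, Finset.sum_apply, hAa p.1 p.2]
  refine Finset.sum_congr rfl fun i _ => ?_
  rw [evalTime_tmul, map_smul, Polynomial.eval_pow, Polynomial.eval_X]
  rfl

lemma isTimeDependentField_timeField (a : CurrentAlgebra (F.LieSections hF U)) :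
    F.IsTimeDependentField (timeField a) := by
  have key : ∃ (N : ℕ) (b : ℕ → F.LieSections hF U), (∀ i, N < i → b i = 0) ∧
      ∀ t, evalTime t a = ∑ i ∈ Finset.range (N + 1), t ^ i • b i := by
    induction a using CurrentAlgebra.induction with
    | zero => exact ⟨0, 0, by simp, by simp⟩
    | tmul q A =>
      refine ⟨q.natDegree, fun i => q.coeff i • A, fun i hi => ?_, fun t => ?_⟩
      · change q.coeff i • A = 0
        rw [Polynomial.coeff_eq_zero_of_natDegree_lt hi, zero_smul]
      · rw [evalTime_tmul, Polynomial.eval_eq_sum_range, Finset.sum_smul]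
        simp only [smul_smul, mul_comm]
    | add a a' h h' =>
      obtain ⟨N, b, hb, hab⟩ := h
      obtain ⟨N', b', hb', hab'⟩ := h'
      have hext : ∀ (n k : ℕ) (c : ℕ → F.LieSections hF U), (∀ i, n < i → c i = 0) → ∀ t : ℂ,
          ∑ i ∈ Finset.range (n + 1), t ^ i • c i =
            ∑ i ∈ Finset.range (n + k + 1), t ^ i • c i := by
        intro n k c hc t
        refine Finset.sum_subset (fun i hi => ?_) fun i _ hi => ?_
        · simp only [Finset.mem_range] at hi ⊢; omega
        · simp only [Finset.mem_range] at hi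
          rw [hc i (by omega), smul_zero]
      refine ⟨N + N', b + b', fun i hi => ?_, fun t => ?_⟩
      · rw [Pi.add_apply, hb i (by omega), hb' i (by omega), add_zero]
      · rw [map_add, hab, hab', hext N N' b hb, hext N' N b' hb', Nat.add_comm N' N,
          ← Finset.sum_add_distrib]
        simp only [Pi.add_apply, smul_add]
  obtain ⟨N, b, -, hb⟩ := key
  refine ⟨N, fun i => (b i).val, fun i => LieSections.val_mem _, fun x t => ?_⟩
  unfold timeField
  rw [hb, map_sum, Finset.sum_apply]
  simp only [map_smul]
  rfl

end TimeField

/-! ### Jets and integral curves -/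

section TruncatedPolynomials

lemma truncatedSum_eq_mk_iff {n : ℕ} {c : ℕ → ℂ} {q : ℂ[X]} :
    truncatedSum n c = Ideal.Quotient.mk _ q ↔ ∀ k ≤ n, c k = q.coeff k := by
  unfold truncatedSum
  rw [Ideal.Quotient.eq, Ideal.mem_span_singleton, Polynomial.X_pow_dvd_iff]
  refine ⟨fun h k hk => ?_, fun h k hk => ?_⟩
  · have := h k (by omega)
    rw [Polynomial.coeff_sub, sub_eq_zero, Polynomial.finsetSum_coeff] at this
    simpa [Polynomial.coeff_C_mul, Polynomial.coeff_X_pow, Nat.lt_succ_iff, hk] using this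
  · rw [Polynomial.coeff_sub, sub_eq_zero, Polynomial.finsetSum_coeff, ← h k (by omega)]
    simp [Polynomial.coeff_C_mul, Polynomial.coeff_X_pow, hk]

lemma truncatedSum_eq_iff {n : ℕ} {c d : ℕ → ℂ} :
    truncatedSum n c = truncatedSum n d ↔ ∀ k ≤ n, c k = d k := by
  have h : ∀ k ≤ n, d k =
      (∑ k ∈ Finset.range (n + 1), Polynomial.C (d k) * Polynomial.X ^ k : ℂ[X]).coeff k :=
    truncatedSum_eq_mk_iff.1 rfl
  exact truncatedSum_eq_mk_iff.trans (forall₂_congr fun k hk => by rw [← h k hk])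

lemma truncatedSum_add (n : ℕ) (c d : ℕ → ℂ) :
    truncatedSum n (c + d) = truncatedSum n c + truncatedSum n d := by
  unfold truncatedSum
  rw [← map_add, ← Finset.sum_add_distrib]
  simp only [Pi.add_apply, map_add, add_mul]

lemma truncatedSum_smul (n : ℕ) (a : ℂ) (c : ℕ → ℂ) :
    truncatedSum n (a • c) = a • truncatedSum n c := by
  unfold truncatedSum
  rw [← Ideal.Quotient.mkₐ_eq_mk ℂ, ← map_smul, Finset.smul_sum]
  simp only [Pi.smul_apply, smul_eq_mul, map_mul, Polynomial.smul_eq_C_mul, mul_assoc]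

lemma truncatedSum_mul (n : ℕ) (c d : ℕ → ℂ) :
    truncatedSum n (fun k => ∑ i ∈ Finset.range (k + 1), c i * d (k - i)) =
      truncatedSum n c * truncatedSum n d := by
  have h : ∀ c : ℕ → ℂ, ∀ k ≤ n, c k =
      (∑ k ∈ Finset.range (n + 1), Polynomial.C (c k) * Polynomial.X ^ k : ℂ[X]).coeff k :=
    fun c => truncatedSum_eq_mk_iff.1 rfl
  change _ = Ideal.Quotient.mk _ _ * Ideal.Quotient.mk _ _
  rw [← map_mul, truncatedSum_eq_mk_iff]
  intro k hk
  rw [Polynomial.coeff_mul, Finset.Nat.sum_antidiagonal_eq_sum_range_succ_mk]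
  refine Finset.sum_congr rfl fun i hi => ?_
  rw [Finset.mem_range] at hi
  rw [← h c i (by omega), ← h d (k - i) (by omega)]

end TruncatedPolynomials

section Jets

variable {E X : Type u} [NormedAddCommGroup E] [NormedSpace ℂ E]
  [TopologicalSpace X] [ChartedSpace E X]

lemma Jet.ext {n : ℕ} {x : X} {σ σ' : Jet E n x}
    (h : ∀ (g : X → ℂ) (hg : ContMDiffAt 𝓘(ℂ, E) 𝓘(ℂ) ω g x),
      σ (germAt g hg) = σ' (germAt g hg)) : σ = σ' := by
  refine AlgHom.ext fun φ => ?_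
  obtain ⟨φ, g, hg, rfl⟩ := φ
  exact h g hg

lemma Jet.truncate_apply {n : ℕ} {x : X} {σ : Jet E (n + 1) x} {φ : holomorphicGerms E x}
    {c : ℕ → ℂ} (h : σ φ = truncatedSum (n + 1) c) : σ.truncate φ = truncatedSum n c := by
  have hc : ∀ k ≤ n + 1, c k = (∑ k ∈ Finset.range (n + 1 + 1),
      Polynomial.C (c k) * Polynomial.X ^ k : ℂ[X]).coeff k := truncatedSum_eq_mk_iff.1 rfl
  unfold Jet.truncate
  rw [AlgHom.comp_apply, h]
  exact (truncatedSum_eq_mk_iff.2 fun k hk => hc k (by omega)).symm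

/-- The Taylor polynomials at `0` of the functions `g ∘ γ` form a jet at `γ 0`. -/
lemma exists_isJetOf {x : X} {γ : ℂ → X} (hγ : Tendsto γ (𝓝 0) (𝓝 x))
    (han : ∀ g : X → ℂ, ContMDiffAt 𝓘(ℂ, E) 𝓘(ℂ) ω g x → ContDiffAt ℂ ω (g ∘ γ) 0) (n : ℕ) :
    ∃ σ : Jet E n x, σ.IsJetOf γ := by
  let T : (X → ℂ) → TruncatedPolynomial n := fun g =>
    truncatedSum n fun k => (k.factorial : ℂ)⁻¹ * iteratedDeriv k (g ∘ γ) 0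
  have hT : ∀ g g' : X → ℂ, g =ᶠ[𝓝 x] g' → T g = T g' := by
    intro g g' h
    have h' : g ∘ γ =ᶠ[𝓝 0] g' ∘ γ := hγ.eventually h
    refine truncatedSum_eq_iff.2 fun k _ => ?_
    rw [h'.iteratedDeriv_eq]
  choose rep hrep hrep' using fun φ : holomorphicGerms E x => φ.2
  have hcongr : ∀ (φ : holomorphicGerms E x) (g : X → ℂ), φ.1 = (g : Germ (𝓝 x) ℂ) →
      T (rep φ) = T g := fun φ g h => hT _ _ (Germ.coe_eq.1 ((hrep' φ).symm.trans h))
  let L : holomorphicGerms E x →ₗ[ℂ] TruncatedPolynomial n :=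
    { toFun := fun φ => T (rep φ)
      map_add' := fun φ ψ => by
        rw [hcongr (φ + ψ) (rep φ + rep ψ) (congrArg₂ (· + ·) (hrep' φ) (hrep' ψ)),
          ← truncatedSum_add]
        refine truncatedSum_eq_iff.2 fun k _ => ?_
        rw [Pi.add_apply, ← mul_add]
        congr 1
        exact iteratedDeriv_add ((han _ (hrep φ)).of_le (by simp))
          ((han _ (hrep ψ)).of_le (by simp))
      map_smul' := fun a φ => by
        rw [hcongr (a • φ) (a • rep φ) (congrArg (a • ·) (hrep' φ)), RingHom.id_apply,
          ← truncatedSum_smul]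
        refine truncatedSum_eq_iff.2 fun k _ => ?_
        rw [Pi.smul_apply, smul_eq_mul, mul_left_comm]
        congr 1
        exact iteratedDeriv_const_smul ((han _ (hrep φ)).of_le (by simp)) a }
  refine ⟨AlgHom.ofLinearMap L ?_ ?_, fun g hg => hcongr _ g rfl⟩
  · have h1 : L 1 = T 1 := hcongr 1 1 rfl
    rw [h1]
    change _ = Ideal.Quotient.mk _ 1
    refine truncatedSum_eq_mk_iff.2 fun k _ => ?_
    have : (1 : X → ℂ) ∘ γ = fun _ => (1 : ℂ) := rfl
    rw [this, iteratedDeriv_const, Polynomial.coeff_one]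
    rcases eq_or_ne k 0 with rfl | hk
    · simp
    · simp [hk]
  · intro φ ψ
    have h1 : L (φ * ψ) = T (rep φ * rep ψ) :=
      hcongr (φ * ψ) (rep φ * rep ψ) (congrArg₂ (· * ·) (hrep' φ) (hrep' ψ))
    rw [h1]
    change _ = T (rep φ) * T (rep ψ)
    rw [← truncatedSum_mul]
    refine truncatedSum_eq_iff.2 fun k _ => ?_
    have h2 : (rep φ * rep ψ) ∘ γ = (rep φ ∘ γ) * (rep ψ ∘ γ) := rfl
    rw [h2, iteratedDeriv_mul ((han _ (hrep φ)).of_le (by simp))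
      ((han _ (hrep ψ)).of_le (by simp)), Finset.mul_sum]
    refine Finset.sum_congr rfl fun i hi => ?_
    rw [Finset.mem_range] at hi
    rw [Nat.cast_choose ℂ (Nat.lt_succ_iff.1 hi)]
    have := Nat.factorial_ne_zero k
    field_simp

end Jets

section IntegralCurves

variable {B H M F : Type*} [NormedAddCommGroup B] [NormedSpace ℂ B] [TopologicalSpace H]
  {I : ModelWithCorners ℂ B H} [TopologicalSpace M] [ChartedSpace H M] [IsManifold I ω M]
  [NormedAddCommGroup F] [NormedSpace ℂ F]

/-- Along an integral curve of `V`, the time derivatives of `f` are the iterated derivatives of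
`f` along `V`. -/
lemma iteratedDeriv_comp_integralCurve {V : ∀ p : M, TangentSpace I p} {f : M → F} {δ : ℂ → M}
    (hV : ContMDiffAt I I.tangent ω (fun q => (⟨q, V q⟩ : TangentBundle I M)) (δ 0))
    (hf : ContMDiffAt I 𝓘(ℂ, F) ω f (δ 0))
    (hδ : ∀ᶠ t in 𝓝 (0 : ℂ), HasMFDerivAt 𝓘(ℂ) I δ t ((1 : ℂ →L[ℂ] ℂ).smulRight (V (δ t))))
    (k : ℕ) : iteratedDeriv k (f ∘ δ) =ᶠ[𝓝 0] (fieldDeriv I V)^[k] f ∘ δ := by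
  induction k with
  | zero => rw [iteratedDeriv_zero]; rfl
  | succ k ih =>
    rw [iteratedDeriv_succ, Function.iterate_succ_apply']
    have hd : ∀ᶠ t in 𝓝 (0 : ℂ), MDifferentiableAt I 𝓘(ℂ, F) ((fieldDeriv I V)^[k] f) (δ t) :=
      hδ.self_of_nhds.continuousAt.eventually
        (eventually_mdifferentiableAt (contMDiffAt_iterate_fieldDeriv hV hf k))
    filter_upwards [ih.eventuallyEq_nhds, hδ, hd] with t ht h1 h2
    let L : B →L[ℂ] F := mfderiv I 𝓘(ℂ, F) ((fieldDeriv I V)^[k] f) (δ t)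
    let b : B := V (δ t)
    have h3 : HasFDerivAt ((fieldDeriv I V)^[k] f ∘ δ)
        (L.comp ((1 : ℂ →L[ℂ] ℂ).smulRight b)) t :=
      (h2.hasMFDerivAt.comp t h1).hasFDerivAt
    rw [ht.deriv_eq, h3.hasDerivAt.deriv]
    change L ((1 : ℂ) • b) = L b
    rw [one_smul]

end IntegralCurves

section FlowJets

variable {E X : Type u} [NormedAddCommGroup E] [NormedSpace ℂ E]
  [TopologicalSpace X] [ChartedSpace E X] [IsManifold 𝓘(ℂ, E) ω X] [CompleteSpace E]
  {F : VectorFieldSheaf E X} {hF : F.LieClosed} {U : Opens X}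

/-- The `k`-th time derivative at time `0` of `g` along the integral curve through `x` of the
time-dependent vector field given by `a`. -/
def flowTaylor (a : CurrentAlgebra (F.LieSections hF U)) (g : X → ℂ) (k : ℕ) (x : X) : ℂ :=
  (fieldDeriv (𝓘(ℂ, E).prod 𝓘(ℂ)) (constantFlow (timeField a)))^[k] (g ∘ Prod.fst) (x, 0)

lemma contMDiffAt_flowTaylor (a : CurrentAlgebra (F.LieSections hF U)) {g : X → ℂ} {x : X}
    (hx : x ∈ U) (hg : ContMDiffAt 𝓘(ℂ, E) 𝓘(ℂ) ω g x) (k : ℕ) :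
    ContMDiffAt 𝓘(ℂ, E) 𝓘(ℂ) ω (flowTaylor a g k) x :=
  ContMDiffAt.comp x (contMDiffAt_iterate_fieldDeriv (contMDiffAt_constantFlow a (p := (x, 0)) hx)
    (ContMDiffAt.comp (x, (0 : ℂ)) hg contMDiffAt_fst) k)
    (contMDiffAt_id.prodMk contMDiffAt_const)

lemma iteratedDeriv_integralCurve (a : CurrentAlgebra (F.LieSections hF U)) {γ : ℂ → X} {x : X}
    (hx : x ∈ U) (hγ : IsIntegralCurveGerm (timeField a) x γ) {g : X → ℂ}
    (hg : ContMDiffAt 𝓘(ℂ, E) 𝓘(ℂ) ω g x) (k : ℕ) :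
    iteratedDeriv k (g ∘ γ) 0 = flowTaylor a g k x := by
  obtain ⟨rfl, hγ⟩ := hγ
  have hδ : ∀ᶠ t in 𝓝 (0 : ℂ), HasMFDerivAt 𝓘(ℂ) (𝓘(ℂ, E).prod 𝓘(ℂ)) (fun t => (γ t, t)) t
      ((1 : ℂ →L[ℂ] ℂ).smulRight (constantFlow (timeField a) (γ t, t))) := by
    filter_upwards [hγ] with t ht
    refine (ht.prodMk (hasMFDerivAt_id t)).congr_mfderiv ?_
    refine ContinuousLinearMap.ext fun c : ℂ => ?_
    exact Prod.ext rfl (mul_one c).symm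
  exact (iteratedDeriv_comp_integralCurve (δ := fun t => (γ t, t))
    (contMDiffAt_constantFlow a (p := (γ 0, 0)) hx)
    (ContMDiffAt.comp (γ 0, (0 : ℂ)) hg contMDiffAt_fst) hδ k).self_of_nhds

lemma exists_isIntegralCurveGerm (a : CurrentAlgebra (F.LieSections hF U)) {x : X} (hx : x ∈ U) :
    ∃ γ : ℂ → X, IsIntegralCurveGerm (timeField a) x γ := by
  set φ := extChartAt 𝓘(ℂ, E) x with hφ
  have hφx : φ.symm (φ x) = x := extChartAt_to_inv x
  -- the time-dependent field in the chart at `x`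
  let v : ℂ × E → E := fun q => fieldDeriv (𝓘(ℂ, E).prod 𝓘(ℂ)) (horizontal (timeField a))
    (φ ∘ Prod.fst) (φ.symm q.2, q.1)
  have hsymm : ContMDiffAt 𝓘(ℂ, E) 𝓘(ℂ, E) ω φ.symm (φ x) :=
    contMDiffOn_extChartAt_symm x |>.contMDiffAt (extChartAt_target_mem_nhds x)
  have hv : ContDiffAt ℂ 1 v (0, φ x) := by
    have h1 : ContMDiffAt 𝓘(ℂ, ℂ × E) (𝓘(ℂ, E).prod 𝓘(ℂ)) ω
        (fun q : ℂ × E => (φ.symm q.2, q.1)) (0, φ x) :=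
      (ContMDiffAt.comp (0, φ x) hsymm contDiffAt_snd.contMDiffAt).prodMk
        contDiffAt_fst.contMDiffAt
    have h2 : ContMDiffAt (𝓘(ℂ, E).prod 𝓘(ℂ)) 𝓘(ℂ, E) ω
        (fieldDeriv (𝓘(ℂ, E).prod 𝓘(ℂ)) (horizontal (timeField a)) (φ ∘ Prod.fst))
        (φ.symm (φ x), (0 : ℂ)) := by
      rw [hφx]
      exact contMDiffAt_fieldDeriv (contMDiffAt_horizontal a (p := (x, 0)) hx)
        (ContMDiffAt.comp (x, (0 : ℂ)) (contMDiffAt_extChartAt (n := ω)) contMDiffAt_fst)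
    exact (ContMDiffAt.comp (0, φ x) h2 h1).contDiffAt.of_le (by simp)
  obtain ⟨u, hu0, hu⟩ := exists_eventually_hasDerivAt hv
  refine ⟨φ.symm ∘ u, (congrArg φ.symm hu0).trans hφx, ?_⟩
  have hut : ∀ᶠ t in 𝓝 (0 : ℂ), u t ∈ φ.target := by
    have hc := hu.self_of_nhds.continuousAt
    refine hc.eventually ?_
    rw [hu0]
    exact extChartAt_target_mem_nhds x
  filter_upwards [hu, hut] with t ht htt
  have hmem : φ.symm (u t) ∈ φ.source := φ.map_target htt
  have hs : MDifferentiableAt 𝓘(ℂ, E) 𝓘(ℂ, E) φ.symm (u t) :=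
    (contMDiffOn_extChartAt_symm (n := ω) x |>.contMDiffAt
      ((isOpen_extChartAt_target x).mem_nhds htt)).mdifferentiableAt (by simp)
  have hφd : MDifferentiableAt 𝓘(ℂ, E) 𝓘(ℂ, E) φ (φ.symm (u t)) :=
    mdifferentiableAt_extChartAt (by rwa [← extChartAt_source 𝓘(ℂ, E)])
  have hw : v (t, u t) = mfderiv 𝓘(ℂ, E) 𝓘(ℂ, E) φ (φ.symm (u t))
      (extendZero (evalTime t a).val (φ.symm (u t))) :=
    fieldDeriv_comp_fst (p := (φ.symm (u t), t)) hφd (horizontal_timeField a _)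
  have hinv : (mfderiv 𝓘(ℂ, E) 𝓘(ℂ, E) φ.symm (u t) : E →L[ℂ] E).comp
      (mfderiv 𝓘(ℂ, E) 𝓘(ℂ, E) φ (φ.symm (u t)) : E →L[ℂ] E) = ContinuousLinearMap.id ℂ E := by
    have := mfderivWithin_extChartAt_symm_comp_mfderiv_extChartAt (I := 𝓘(ℂ, E)) htt
    rwa [ModelWithCorners.range_eq_univ, mfderivWithin_univ] at this
  have key : (mfderiv 𝓘(ℂ, E) 𝓘(ℂ, E) φ.symm (u t) : E →L[ℂ] E) (v (t, u t)) =
      extendZero (evalTime t a).val (φ.symm (u t)) := by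
    rw [hw]
    exact congrArg (fun L : E →L[ℂ] E => L (extendZero (evalTime t a).val (φ.symm (u t)))) hinv
  refine (hs.hasMFDerivAt.comp t ht.hasFDerivAt.hasMFDerivAt).congr_mfderiv ?_
  refine ContinuousLinearMap.ext fun c : ℂ => ?_
  change (mfderiv 𝓘(ℂ, E) 𝓘(ℂ, E) φ.symm (u t) : E →L[ℂ] E) (c • v (t, u t)) =
    c • (extendZero (evalTime t a).val (φ.symm (u t)) : E)
  exact ((mfderiv 𝓘(ℂ, E) 𝓘(ℂ, E) φ.symm (u t) : E →L[ℂ] E).map_smul c (v (t, u t))).trans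
    (congrArg (fun e : E => c • e) key)

/-- The jet induced by a time-dependent vector field is described by iterated derivatives along
`∂/∂t + a`. -/
lemma isInducedBy_timeField_iff (a : CurrentAlgebra (F.LieSections hF U)) {x : X} (hx : x ∈ U)
    {n : ℕ} (σ : Jet E n x) : σ.IsInducedBy (timeField a) ↔
      ∀ (g : X → ℂ) (hg : ContMDiffAt 𝓘(ℂ, E) 𝓘(ℂ) ω g x), σ (germAt g hg) =
        truncatedSum n fun k => (k.factorial : ℂ)⁻¹ * flowTaylor a g k x := by
  constructor
  · rintro ⟨γ, hγ, hσ⟩ g hg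
    rw [hσ g hg]
    exact truncatedSum_eq_iff.2 fun k _ => by rw [iteratedDeriv_integralCurve a hx hγ hg]
  · intro h
    obtain ⟨γ, hγ⟩ := exists_isIntegralCurveGerm a hx
    refine ⟨γ, hγ, fun g hg => ?_⟩
    rw [h g hg]
    exact truncatedSum_eq_iff.2 fun k _ => by rw [iteratedDeriv_integralCurve a hx hγ hg]

lemma exists_isInducedBy_timeField (a : CurrentAlgebra (F.LieSections hF U)) {x : X} (hx : x ∈ U)
    (n : ℕ) : ∃ σ : Jet E n x, σ.IsInducedBy (timeField a) := by
  obtain ⟨γ, hγ⟩ := exists_isIntegralCurveGerm a hx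
  have hc : Tendsto γ (𝓝 0) (𝓝 x) := by
    have := hγ.2.self_of_nhds.continuousAt
    rwa [ContinuousAt, hγ.1] at this
  have han : ∀ g : X → ℂ, ContMDiffAt 𝓘(ℂ, E) 𝓘(ℂ) ω g x → ContDiffAt ℂ ω (g ∘ γ) 0 := by
    intro g hg
    refine AnalyticAt.contDiffAt (Complex.analyticAt_iff_eventually_differentiableAt.2 ?_)
    filter_upwards [hγ.2, hc.eventually (eventually_mdifferentiableAt hg)] with t h1 h2
    exact (h2.hasMFDerivAt.comp t h1).hasFDerivAt.differentiableAt
  obtain ⟨σ, hσ⟩ := exists_isJetOf hc han n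
  exact ⟨σ, γ, hγ, hσ⟩

end FlowJets

/-! ### Comparison of time-dependent vector fields -/

section Locality

variable {B H M F : Type*} [NormedAddCommGroup B] [NormedSpace ℂ B] [TopologicalSpace H]
  {I : ModelWithCorners ℂ B H} [TopologicalSpace M] [ChartedSpace H M]
  [NormedAddCommGroup F] [NormedSpace ℂ F]

lemma iterate_fieldDeriv_congr_field {V W : ∀ p : M, TangentSpace I p} {p : M} (h : V =ᶠ[𝓝 p] W)
    (f : M → F) (k : ℕ) : (fieldDeriv I V)^[k] f =ᶠ[𝓝 p] (fieldDeriv I W)^[k] f := by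
  induction k with
  | zero => rfl
  | succ k ih =>
    simp only [Function.iterate_succ_apply']
    filter_upwards [ih.eventuallyEq_nhds, h] with q hq hV
    exact fieldDeriv_congr hV hq

lemma iterate_mlieBracket_congr {V W V' W' : ∀ p : M, TangentSpace I p} {p : M}
    (hV : V =ᶠ[𝓝 p] V') (hW : W =ᶠ[𝓝 p] W') (k : ℕ) :
    (mlieBracket I V)^[k] W =ᶠ[𝓝 p] (mlieBracket I V')^[k] W' := by
  induction k with
  | zero => exact hW
  | succ k ih =>
    simp only [Function.iterate_succ_apply']
    exact hV.mlieBracket_vectorField ih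

end Locality

section Restriction

variable {E X : Type u} [NormedAddCommGroup E] [NormedSpace ℂ E]
  [TopologicalSpace X] [ChartedSpace E X] [IsManifold 𝓘(ℂ, E) ω X] [CompleteSpace E]
  {F : VectorFieldSheaf E X} {hF : F.LieClosed} {U W : Opens X}

lemma exists_restrict_timeField (h : W ≤ U) (a : CurrentAlgebra (F.LieSections hF U)) :
    ∃ b : CurrentAlgebra (F.LieSections hF W),
      timeField b = fun p : W × ℂ => timeField a (⟨p.1, h p.1.2⟩, p.2) := by
  obtain ⟨N, c, hc, hac⟩ := isTimeDependentField_timeField a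
  obtain ⟨b, hb⟩ := exists_eq_timeField (hF := hF)
    (A := fun p : W × ℂ => timeField a (⟨p.1, h p.1.2⟩, p.2))
    ⟨N, fun i x => c i ⟨x, h x.2⟩, fun i => F.restrict U W h _ (hc i), fun x t => hac _ t⟩
  exact ⟨b, hb.symm⟩

variable {a : CurrentAlgebra (F.LieSections hF U)} {b : CurrentAlgebra (F.LieSections hF W)}

lemma extendZero_restrict (h : W ≤ U)
    (hb : timeField b = fun p : W × ℂ => timeField a (⟨p.1, h p.1.2⟩, p.2)) {x : X} (hx : x ∈ W)
    (t : ℂ) : extendZero (fun x : W => timeField b (x, t)) x =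
      extendZero (fun x : U => timeField a (x, t)) x := by
  rw [extendZero_apply _ hx, extendZero_apply _ (h hx), hb]

lemma constantFlow_restrict (h : W ≤ U)
    (hb : timeField b = fun p : W × ℂ => timeField a (⟨p.1, h p.1.2⟩, p.2)) {x : X} (hx : x ∈ W)
    (t : ℂ) : constantFlow (timeField b) =ᶠ[𝓝 (x, t)] constantFlow (timeField a) := by
  filter_upwards [(W.isOpen.preimage continuous_fst).mem_nhds (x := (x, t)) hx] with q hq
  exact Prod.ext (extendZero_restrict h hb hq q.2) rfl

lemma horizontal_restrict (h : W ≤ U)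
    (hb : timeField b = fun p : W × ℂ => timeField a (⟨p.1, h p.1.2⟩, p.2)) {x : X} (hx : x ∈ W)
    (t : ℂ) : horizontal (timeField b) =ᶠ[𝓝 (x, t)] horizontal (timeField a) := by
  filter_upwards [(W.isOpen.preimage continuous_fst).mem_nhds (x := (x, t)) hx] with q hq
  exact Prod.ext (extendZero_restrict h hb hq q.2) rfl

lemma flowTaylor_restrict (h : W ≤ U)
    (hb : timeField b = fun p : W × ℂ => timeField a (⟨p.1, h p.1.2⟩, p.2)) {x : X} (hx : x ∈ W)
    (g : X → ℂ) (k : ℕ) : flowTaylor b g k x = flowTaylor a g k x :=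
  (iterate_fieldDeriv_congr_field (constantFlow_restrict h hb hx 0) _ k).self_of_nhds

lemma lieIterateAtZero_restrict (h : W ≤ U)
    (hb : timeField b = fun p : W × ℂ => timeField a (⟨p.1, h p.1.2⟩, p.2)) (m : ℕ) :
    lieIterateAtZero (timeField b) m =
      fun x : W => lieIterateAtZero (timeField a) m ⟨x, h x.2⟩ := by
  funext x
  exact congrArg (fun v : E × ℂ => v.1) (iterate_mlieBracket_congr
    (constantFlow_restrict h hb x.2 0) (horizontal_restrict h hb x.2 0) m).self_of_nhds

lemma InducedSubsheaf.IsAdmissibleField.restrict {Y : Set X} {G : InducedSubsheaf F Y} {n : ℕ}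
    (ha : G.IsAdmissibleField n (timeField a)) (h : W ≤ U)
    (hb : timeField b = fun p : W × ℂ => timeField a (⟨p.1, h p.1.2⟩, p.2)) :
    G.IsAdmissibleField n (timeField b) := by
  refine ⟨isTimeDependentField_timeField b, fun m h1 h2 => ?_⟩
  rw [lieIterateAtZero_restrict h hb m]
  exact G.restrict (trace Y U) (trace Y W) (fun _ hy => h hy) _ (ha.2 m h1 h2)

end Restriction

section Comparison

variable {E X : Type u} [NormedAddCommGroup E] [NormedSpace ℂ E]
  [TopologicalSpace X] [ChartedSpace E X]

variable (E) in
/-- The derivative of the function `g` in the direction of a tangent vector at `x`, as a linear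
functional of the vector. -/
def directionalDeriv (g : X → ℂ) (x : X) : TangentSpace 𝓘(ℂ, E) x →ₗ[ℂ] ℂ :=
  (mfderiv 𝓘(ℂ, E) 𝓘(ℂ) g x : E →L[ℂ] ℂ).toLinearMap

variable [IsManifold 𝓘(ℂ, E) ω X]

lemma eq_zero_of_directionalDeriv_eq_zero {x : X} {v : TangentSpace 𝓘(ℂ, E) x}
    (h : ∀ g : X → ℂ, ContMDiffAt 𝓘(ℂ, E) 𝓘(ℂ) ω g x → directionalDeriv E g x v = 0) : v = 0 := by
  have hφ := contMDiffAt_extChartAt (I := 𝓘(ℂ, E)) (n := ω) (x := x)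
  let C : E →L[ℂ] E := mfderiv 𝓘(ℂ, E) 𝓘(ℂ, E) (extChartAt 𝓘(ℂ, E) x) x
  have hCv : C v = 0 := by
    refine SeparatingDual.eq_zero_of_forall_dual_eq_zero (R := ℂ) fun L => ?_
    have hL : ContMDiffAt 𝓘(ℂ, E) 𝓘(ℂ) ω L (extChartAt 𝓘(ℂ, E) x x) :=
      L.contDiff.contMDiff.contMDiffAt
    have h1 := h (L ∘ extChartAt 𝓘(ℂ, E) x) (ContMDiffAt.comp x hL hφ)
    have h2 : mfderiv 𝓘(ℂ, E) 𝓘(ℂ) (L ∘ extChartAt 𝓘(ℂ, E) x) x = L.comp C := by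
      rw [mfderiv_comp x (hL.mdifferentiableAt (by simp)) (hφ.mdifferentiableAt (by simp)),
        mfderiv_eq_fderiv, L.fderiv]
      rfl
    exact (congrArg (fun D : E →L[ℂ] ℂ => D v) h2).symm.trans h1
  exact mfderiv_extChartAt_injective x (hCv.trans (map_zero C).symm)

lemma eq_of_directionalDeriv_eq {x : X} {v w : TangentSpace 𝓘(ℂ, E) x}
    (h : ∀ g : X → ℂ, ContMDiffAt 𝓘(ℂ, E) 𝓘(ℂ) ω g x →
      directionalDeriv E g x v = directionalDeriv E g x w) : v = w :=
  sub_eq_zero.1 (eq_zero_of_directionalDeriv_eq_zero fun g hg => by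
    rw [map_sub, h g hg, sub_self])

variable [CompleteSpace E] {F : VectorFieldSheaf E X} {hF : F.LieClosed} {U : Opens X}

/-- Changing `a` by a field `c` whose iterated brackets `(∂/∂t + [a, -])^i c` vanish at `x` and
time `0` for `i < k` changes the time derivative of order `k + 1` along the integral curve by the
action of the tangent vector `(∂/∂t + [a, -])^k c`, and does not affect lower orders. -/
theorem flowTaylor_add (a c : CurrentAlgebra (F.LieSections hF U)) {x : X} (hx : x ∈ U) {k : ℕ}
    (hc : ∀ i < k, (evalTime 0 ((flowDeriv a)^[i] c)).val ⟨x, hx⟩ = 0) {g : X → ℂ}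
    (hg : ContMDiffAt 𝓘(ℂ, E) 𝓘(ℂ) ω g x) :
    flowTaylor (a + c) g (k + 1) x = flowTaylor a g (k + 1) x +
      directionalDeriv E g x ((evalTime 0 ((flowDeriv a)^[k] c)).val ⟨x, hx⟩) := by
  let C : ℕ → ∀ p : X × ℂ, TangentSpace (𝓘(ℂ, E).prod 𝓘(ℂ)) p := fun i =>
    (mlieBracket (𝓘(ℂ, E).prod 𝓘(ℂ)) (constantFlow (timeField a)))^[i] (horizontal (timeField c))
  have hCe : ∀ i, C i =ᶠ[𝓝 (x, (0 : ℂ))] horizontal (timeField ((flowDeriv a)^[i] c)) := by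
    intro i
    filter_upwards [(U.isOpen.preimage continuous_fst).mem_nhds (x := (x, (0 : ℂ))) hx] with q hq
    exact iterate_mlieBracket_constantFlow a c i hq
  have hCx : ∀ i, C i (x, (0 : ℂ)) =
      ((evalTime 0 ((flowDeriv a)^[i] c)).val ⟨x, hx⟩, (0 : ℂ)) := by
    intro i
    rw [(hCe i).self_of_nhds, horizontal_timeField]
    exact Prod.ext (extendZero_apply _ hx) rfl
  have h := iterate_succ_fieldDeriv_eq_add (C := C)
    (contMDiffAt_constantFlow a (p := (x, 0)) hx)
    (contMDiffAt_constantFlow (a + c) (p := (x, 0)) hx)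
    (fun i => (contMDiffAt_horizontal ((flowDeriv a)^[i] c) (p := (x, 0)) hx).congr_of_eventuallyEq
      ((hCe i).mono fun q hq => congrArg (fun v : E × ℂ =>
        (⟨q, v⟩ : TangentBundle (𝓘(ℂ, E).prod 𝓘(ℂ)) (X × ℂ))) hq))
    (fun q => by
      have key : ∀ e f : E, f = e + f - e := fun e f => (add_sub_cancel_left e f).symm
      change horizontal (timeField c) q = _
      rw [constantFlow_timeField, constantFlow_timeField, horizontal_timeField, map_add, map_add,
        extendZero_add]
      exact Prod.ext (key _ _) (sub_self (1 : ℂ)).symm)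
    (fun i => Function.iterate_succ_apply' _ _ _) k
    (fun i hi => by rw [hCx, hc i hi]; rfl)
    (g ∘ Prod.fst) (ContMDiffAt.comp (x, (0 : ℂ)) hg contMDiffAt_fst)
  refine h.trans (congrArg₂ (· + ·) rfl ?_)
  exact (fieldDeriv_comp_fst (p := (x, (0 : ℂ))) (hg.mdifferentiableAt (by simp))
    (hCe k).self_of_nhds).trans
      (congrArg (directionalDeriv E g x)
        (extendZero_apply (evalTime 0 ((flowDeriv a)^[k] c)).val hx))

/-- If `a` and `a + c` induce the same jet of order `n` at `x`, then the iterated brackets of order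
less than `n` of `c` along `a` vanish at `x`. -/
lemma iterate_flowDeriv_eq_zero_of_flowTaylor_eq {a c : CurrentAlgebra (F.LieSections hF U)} {x : X}
    (hx : x ∈ U) {n : ℕ} (h : ∀ g : X → ℂ, ContMDiffAt 𝓘(ℂ, E) 𝓘(ℂ) ω g x → ∀ k ≤ n,
      flowTaylor (a + c) g k x = flowTaylor a g k x) {k : ℕ} (hk : k < n) :
    (evalTime 0 ((flowDeriv a)^[k] c)).val ⟨x, hx⟩ = 0 := by
  induction k using Nat.strong_induction_on with
  | _ k ih =>
    refine eq_zero_of_directionalDeriv_eq_zero fun g hg => ?_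
    have h1 := flowTaylor_add a c hx (fun i hi => ih i hi (hi.trans hk)) hg
    rw [h g hg (k + 1) hk] at h1
    exact left_eq_add.1 h1

end Comparison

section Admissible

variable {E X : Type u} [NormedAddCommGroup E] [NormedSpace ℂ E]
  [TopologicalSpace X] [ChartedSpace E X] [IsManifold 𝓘(ℂ, E) ω X] [CompleteSpace E]
  {F : VectorFieldSheaf E X} {hF : F.LieClosed} {U : Opens X} {Y : Set X}

/-- The fields in `F(U)` that induce a section of `G` on `Y ∩ U`. -/
def InducedSubsheaf.fields (G : InducedSubsheaf F Y) (hF : F.LieClosed) (U : Opens X) :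
    AddSubgroup (F.LieSections hF U) where
  carrier := {A | pullback Y A.val ∈ G.sec (trace Y U)}
  add_mem' {A B} hA hB := by
    have : pullback Y (A + B).val = pullback Y A.val + pullback Y B.val := by
      rw [map_add]; rfl
    exact (congrArg (· ∈ G.sec (trace Y U)) this).mpr (add_mem hA hB)
  zero_mem' := by
    have : pullback Y (0 : F.LieSections hF U).val = 0 := by
      rw [map_zero]; rfl
    exact (congrArg (· ∈ G.sec (trace Y U)) this).mpr (zero_mem _)
  neg_mem' {A} hA := by
    have : pullback Y (-A).val = -pullback Y A.val := by
      rw [map_neg]; rfl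
    exact (congrArg (· ∈ G.sec (trace Y U)) this).mpr (neg_mem hA)

/-- Brackets with a field that vanishes along `Y` are obstructions: apply the definition of an
obstruction sheaf to `A + B` and `B`. -/
lemma InducedSubsheaf.lie_mem_fields {G : InducedSubsheaf F Y} (hG : G.IsObstructionSheaf)
    (A : F.LieSections hF U) (hA : ∀ y : trace Y U, pullback Y A.val y = 0)
    (B : F.LieSections hF U) : ⁅A, B⁆ ∈ G.fields hF U := by
  have h : pullback Y (A + B).val = pullback Y B.val := by
    funext y
    have : pullback Y (A + B).val y = pullback Y A.val y + pullback Y B.val y := by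
      rw [map_add]; rfl
    rw [this, hA, zero_add]
  have h2 : ⁅A + B, B⁆ = ⁅A, B⁆ := by rw [add_lie, lie_self, add_zero]
  rw [← h2]
  exact hG U _ (LieSections.val_mem _) _ (LieSections.val_mem _) h

lemma InducedSubsheaf.isAdmissibleField_timeField_iff {G : InducedSubsheaf F Y} {n : ℕ}
    {a : CurrentAlgebra (F.LieSections hF U)} : G.IsAdmissibleField n (timeField a) ↔
      ∀ m, 1 ≤ m → m ≤ n → evalTime 0 ((flowDeriv a)^[m] a) ∈ G.fields hF U := by
  have h : ∀ m, pullback Y (lieIterateAtZero (timeField a) m) ∈ G.sec (trace Y U) ↔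
      evalTime 0 ((flowDeriv a)^[m] a) ∈ G.fields hF U := fun m => by
    rw [lieIterateAtZero_timeField]
    rfl
  exact ⟨fun ha m h1 h2 => (h m).1 (ha.2 m h1 h2),
    fun ha => ⟨isTimeDependentField_timeField a, fun m h1 h2 => (h m).2 (ha m h1 h2)⟩⟩

/-- Two `n`-admissible fields that induce the same `n`-th order jets along `Y` induce jets of order
`n + 1` that differ by a section of `G`. -/
theorem InducedSubsheaf.exists_sec_flowTaylor_sub {G : InducedSubsheaf F Y}
    (hG : G.IsObstructionSheaf) {n : ℕ} (hn : 1 ≤ n) {a b : CurrentAlgebra (F.LieSections hF U)}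
    (ha : G.IsAdmissibleField n (timeField a)) (hb : G.IsAdmissibleField n (timeField b))
    (hab : ∀ y ∈ Y, y ∈ U → ∀ g : X → ℂ, ContMDiffAt 𝓘(ℂ, E) 𝓘(ℂ) ω g y → ∀ k ≤ n,
      flowTaylor b g k y = flowTaylor a g k y) :
    ∃ d ∈ G.sec (trace Y U), ∀ (y : trace Y U) (g : X → ℂ),
      ContMDiffAt 𝓘(ℂ, E) 𝓘(ℂ) ω g ((y : Y) : X) →
      directionalDeriv E g ((y : Y) : X) (d y) =
        flowTaylor b g (n + 1) ((y : Y) : X) - flowTaylor a g (n + 1) ((y : Y) : X) := by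
  rw [isAdmissibleField_timeField_iff] at ha hb
  obtain ⟨c, rfl⟩ : ∃ c, b = a + c := ⟨b - a, by abel⟩
  have hc : ∀ k < n, ∀ y : trace Y U,
      pullback Y (evalTime 0 ((flowDeriv a)^[k] c)).val y = 0 := fun k hk y =>
    iterate_flowDeriv_eq_zero_of_flowTaylor_eq (x := ((y : Y) : X)) (U := U) y.2
      (hab _ (y : Y).2 y.2) hk
  -- The difference of the `(n + 1)`-jets is the bracket of order `n` of `c` along `a`. Modulo
  -- sections of `G` it is the difference of the obstructions of order `n` of `a + c` and `a`.
  have hsub := evalTime_iterate_flowDeriv_sub_mem (H := G.fields hF U)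
    (K := {A : F.LieSections hF U | ∀ y : trace Y U, pullback Y A.val y = 0})
    (lie_mem_fields hG) a c n hc
  have hd : evalTime 0 ((flowDeriv a)^[n] c) ∈ G.fields hF U := by
    have := sub_mem (sub_mem (hb n hn le_rfl) (ha n hn le_rfl)) hsub
    rwa [sub_sub_cancel] at this
  refine ⟨_, hd, fun y g hg => ?_⟩
  have hy : ((y : Y) : X) ∈ U := y.2
  rw [flowTaylor_add a c hy (fun i hi => hc i hi y) hg, add_sub_cancel_left]
  rfl

/-- An `n`-admissible field can be changed into an `(n + 1)`-admissible one that induces the same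
`n`-th order jets, with a jet of order `n + 1` that differs by any prescribed `B` in `F` that
induces a section of `G`. -/
theorem InducedSubsheaf.exists_isAdmissibleField_succ {G : InducedSubsheaf F Y}
    (hG : G.IsObstructionSheaf) {n : ℕ} {a : CurrentAlgebra (F.LieSections hF U)}
    (ha : G.IsAdmissibleField n (timeField a)) {B : F.LieSections hF U} (hB : B ∈ G.fields hF U) :
    ∃ a' : CurrentAlgebra (F.LieSections hF U), G.IsAdmissibleField (n + 1) (timeField a') ∧
      ∀ (x : X) (hx : x ∈ U) (g : X → ℂ), ContMDiffAt 𝓘(ℂ, E) 𝓘(ℂ) ω g x →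
        (∀ k ≤ n, flowTaylor a' g k x = flowTaylor a g k x) ∧
        flowTaylor a' g (n + 1) x =
          flowTaylor a g (n + 1) x - directionalDeriv E g x (B.val ⟨x, hx⟩) := by
  rw [isAdmissibleField_timeField_iff] at ha
  have hfac : ∀ n : ℕ, (n.factorial : ℂ) ≠ 0 := fun n => Nat.cast_ne_zero.2 n.factorial_ne_zero
  -- `D = -B / n!`, and `t ^ n D` shifts the obstruction of order `n` by `-B`.
  let D : F.LieSections hF U := -((n.factorial : ℂ)⁻¹ • B)
  let c := (Polynomial.X ^ n : ℂ[X]) • monomialTerm 1 D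
  have hclt : ∀ k < n, evalTime 0 ((flowDeriv a)^[k] c) = 0 := fun k hk =>
    evalTime_iterate_flowDeriv_X_pow_smul_of_lt a _ hk
  have hcn : evalTime 0 ((flowDeriv a)^[n] c) = -B := by
    rw [evalTime_iterate_flowDeriv_X_pow_smul_self, evalTime_tmul, Polynomial.eval_one, one_smul,
      smul_neg, smul_smul, mul_inv_cancel₀ (hfac n), one_smul]
  -- The term `t ^ (n + 1) D'` cancels the obstruction of order `n + 1`.
  let D' : F.LieSections hF U :=
    -(((n + 1).factorial : ℂ)⁻¹ • evalTime 0 ((flowDeriv (a + c))^[n + 1] (a + c)))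
  let c' := (Polynomial.X ^ (n + 1) : ℂ[X]) • monomialTerm 1 D'
  have hclt' : ∀ k < n + 1, evalTime 0 ((flowDeriv (a + c))^[k] c') = 0 := fun k hk =>
    evalTime_iterate_flowDeriv_X_pow_smul_of_lt (a + c) _ hk
  have hcn' : evalTime 0 ((flowDeriv (a + c))^[n + 1] c') =
      -evalTime 0 ((flowDeriv (a + c))^[n + 1] (a + c)) := by
    rw [evalTime_iterate_flowDeriv_X_pow_smul_self, evalTime_tmul, Polynomial.eval_one, one_smul,
      smul_neg, smul_smul, mul_inv_cancel₀ (hfac _), one_smul]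
  have hK : ∀ A : F.LieSections hF U, A = 0 →
      A ∈ {A : F.LieSections hF U | ∀ y : trace Y U, pullback Y A.val y = 0} := by
    rintro _ rfl y
    rw [map_zero]
    rfl
  have hadd : ∀ m, 1 ≤ m → m ≤ n →
      evalTime 0 ((flowDeriv (a + c))^[m] (a + c)) ∈ G.fields hF U := by
    intro m h1 h2
    have hsub := evalTime_iterate_flowDeriv_sub_mem (H := G.fields hF U) (lie_mem_fields hG) a c m
      fun k hk => hK _ (hclt k (by omega))
    have hcm : evalTime 0 ((flowDeriv a)^[m] c) ∈ G.fields hF U := by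
      rcases h2.lt_or_eq with h2 | rfl
      · rw [hclt m h2]; exact zero_mem _
      · rw [hcn]; exact neg_mem hB
    rw [sub_sub] at hsub
    simpa using add_mem hsub (add_mem (ha m h1 h2) hcm)
  refine ⟨a + c + c', isAdmissibleField_timeField_iff.2 fun m h1 h2 => ?_, fun x hx g hg => ?_⟩
  · have hsub := evalTime_iterate_flowDeriv_sub_mem (H := G.fields hF U) (lie_mem_fields hG) (a + c)
      c' m fun k hk => hK _ (hclt' k (by omega))
    rcases Nat.lt_or_ge m (n + 1) with h | h
    · rw [hclt' m h, sub_zero] at hsub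
      simpa using add_mem hsub (hadd m h1 (by omega))
    · obtain rfl : m = n + 1 := le_antisymm h2 h
      rwa [hcn', sub_neg_eq_add, sub_add_cancel] at hsub
  · have hval : ∀ A : F.LieSections hF U, A = 0 → A.val ⟨x, hx⟩ = 0 := by
      rintro _ rfl
      rw [map_zero]
      rfl
    have hzero : ∀ b : CurrentAlgebra (F.LieSections hF U), flowTaylor b g 0 x = g x := fun _ => rfl
    have h1 : ∀ k ≤ n, flowTaylor (a + c + c') g (k + 1) x = flowTaylor (a + c) g (k + 1) x := by
      intro k hk
      rw [flowTaylor_add (a + c) c' hx (fun i hi => hval _ (hclt' i (by omega))) hg,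
        hval _ (hclt' k (by omega)), map_zero, add_zero]
    have h2 : ∀ k ≤ n, flowTaylor (a + c) g (k + 1) x = flowTaylor a g (k + 1) x +
        directionalDeriv E g x ((evalTime 0 ((flowDeriv a)^[k] c)).val ⟨x, hx⟩) := fun k hk =>
      flowTaylor_add a c hx (fun i hi => hval _ (hclt i (by omega))) hg
    refine ⟨fun k hk => ?_, ?_⟩
    · rcases k with _ | k
      · rw [hzero, hzero]
      · rw [h1 k (by omega), h2 k (by omega), hval _ (hclt k (by omega)), map_zero, add_zero]
    · rw [h1 n le_rfl, h2 n le_rfl, hcn, map_neg, Pi.neg_apply, map_neg, sub_eq_add_neg]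

end Admissible

/-! ### Lifting admissible sections -/

section Lifting

variable {E X : Type u} [NormedAddCommGroup E] [NormedSpace ℂ E]
  [TopologicalSpace X] [ChartedSpace E X] [IsManifold 𝓘(ℂ, E) ω X] [CompleteSpace E]
  {F : VectorFieldSheaf E X} {Y : Set X}

/-- Admissible sections lift over a manifold modelled on any complex Banach space. -/
theorem JetSection.IsAdmissible.exists_lift {G : InducedSubsheaf F Y} {n : ℕ}
    {τ : JetSection E Y n} (hτ : τ.IsAdmissible G) (hF : F.LieClosed) (hG : G.IsObstructionSheaf)
    (hH : Subsingleton (Sheaf.H G.toSheaf 1)) (hn : 1 ≤ n) :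
    ∃ τ' : JetSection E Y (n + 1),
      (∀ y : Y, (τ'.toFun y).truncate = τ.toFun y) ∧ τ'.IsAdmissible G := by
  have hfac : ∀ n : ℕ, (n.factorial : ℂ)⁻¹ ≠ 0 := fun n =>
    inv_ne_zero (Nat.cast_ne_zero.2 n.factorial_ne_zero)
  obtain ⟨J, U, A, hcov, hadm, hind⟩ := hτ
  choose a ha using fun j => exists_eq_timeField (hF := hF) (hadm j).1
  obtain rfl : A = fun j => timeField (a j) := funext ha
  have hτa : ∀ (j : J) (y : Y), (y : X) ∈ U j → ∀ (g : X → ℂ)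
      (hg : ContMDiffAt 𝓘(ℂ, E) 𝓘(ℂ) ω g (y : X)), τ.toFun y (germAt g hg) =
        truncatedSum n fun k => (k.factorial : ℂ)⁻¹ * flowTaylor (a j) g k (y : X) :=
    fun j y hy => (isInducedBy_timeField_iff (a j) hy _).1 (hind j y hy)
  have hagree : ∀ (i j : J) (y : Y), (y : X) ∈ U i → (y : X) ∈ U j → ∀ g : X → ℂ,
      ContMDiffAt 𝓘(ℂ, E) 𝓘(ℂ) ω g (y : X) → ∀ k ≤ n,
      flowTaylor (a i) g k (y : X) = flowTaylor (a j) g k (y : X) := fun i j y hi hj g hg k hk =>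
    mul_left_cancel₀ (hfac k)
      (truncatedSum_eq_iff.1 ((hτa i y hi g hg).symm.trans (hτa j y hj g hg)) k hk)
  have hcocycle : ∀ i j : J, ∃ d ∈ G.sec (trace Y (U i ⊓ U j)),
      ∀ (y : trace Y (U i ⊓ U j)) (g : X → ℂ), ContMDiffAt 𝓘(ℂ, E) 𝓘(ℂ) ω g ((y : Y) : X) →
      directionalDeriv E g ((y : Y) : X) (d y) = flowTaylor (a j) g (n + 1) ((y : Y) : X) -
        flowTaylor (a i) g (n + 1) ((y : Y) : X) := by
    intro i j
    have hi : U i ⊓ U j ≤ U i := inf_le_left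
    have hj : U i ⊓ U j ≤ U j := inf_le_right
    obtain ⟨b, hb⟩ := exists_restrict_timeField hi (a i)
    obtain ⟨b', hb'⟩ := exists_restrict_timeField hj (a j)
    obtain ⟨d, hd, hdT⟩ := InducedSubsheaf.exists_sec_flowTaylor_sub hG hn
      ((hadm i).restrict hi hb) ((hadm j).restrict hj hb') fun y hyY hyU g hg k hk => by
        rw [flowTaylor_restrict hi hb hyU, flowTaylor_restrict hj hb' hyU]
        exact hagree j i ⟨y, hyY⟩ (hj hyU) (hi hyU) g hg k hk
    refine ⟨d, hd, fun y g hg => ?_⟩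
    have hy : ((y : Y) : X) ∈ U i ⊓ U j := y.2
    rw [hdT y g hg, flowTaylor_restrict hi hb hy, flowTaylor_restrict hj hb' hy]
  choose d hd hdT using hcocycle
  choose idx hidx using fun y : Y => hcov (y : X) y.2
  -- The cocycle `d` is the coboundary of a cochain `h` of sections of `f^* T_X` that need not be
  -- continuous: `h j` compares the jet of order `n + 1` of `a j` with the one of a field chosen
  -- separately at each point.
  let h : ∀ j, ∀ y : trace Y (U j), TangentSpace 𝓘(ℂ, E) ((y : Y) : X) := fun j y =>
    d (idx y) j ⟨y, hidx y, y.2⟩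
  have hh : ∀ (j : J) (y : trace Y (U j)) (g : X → ℂ),
      ContMDiffAt 𝓘(ℂ, E) 𝓘(ℂ) ω g ((y : Y) : X) → directionalDeriv E g ((y : Y) : X) (h j y) =
        flowTaylor (a j) g (n + 1) ((y : Y) : X) -
          flowTaylor (a (idx y)) g (n + 1) ((y : Y) : X) :=
    fun j y g hg => hdT (idx y) j ⟨y, hidx y, y.2⟩ g hg
  obtain ⟨p, hp⟩ := G.exists_global_section hH (fun j => trace Y (U j)) (fun y => ⟨idx y, hidx y⟩)
    h fun i j => by
      have : (fun y : (trace Y (U i) ⊓ trace Y (U j) : Opens Y) =>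
          h i ⟨y, y.2.1⟩ - h j ⟨y, y.2.2⟩) =
          fun y : (trace Y (U i) ⊓ trace Y (U j) : Opens Y) => d j i ⟨y, y.2.2, y.2.1⟩ := by
        funext y
        refine eq_of_directionalDeriv_eq fun g hg => ?_
        rw [map_sub, hh i ⟨y, y.2.1⟩ g hg, hh j ⟨y, y.2.2⟩ g hg]
        exact (sub_sub_sub_cancel_right _ _ _).trans (hdT j i ⟨y, y.2.2, y.2.1⟩ g hg).symm
      rw [this]
      exact G.restrict (trace Y (U j ⊓ U i)) (trace Y (U i) ⊓ trace Y (U j))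
        (fun y hy => ⟨hy.2, hy.1⟩) _ (hd j i)
  -- The sections `h j - p` of `G` extend locally to fields in `F`, by which the jets of order
  -- `n + 1` of the `a j` are corrected; the corrected jets do not depend on `j`.
  have hlocal : ∀ y₀ : Y, ∃ (W : Opens X) (b : CurrentAlgebra (F.LieSections hF W)),
      (y₀ : X) ∈ W ∧ G.IsAdmissibleField (n + 1) (timeField b) ∧ ∀ y : Y, (y : X) ∈ W →
      ∀ g : X → ℂ, ContMDiffAt 𝓘(ℂ, E) 𝓘(ℂ) ω g (y : X) →
      (∀ k ≤ n, flowTaylor b g k (y : X) = flowTaylor (a (idx y)) g k (y : X)) ∧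
      flowTaylor b g (n + 1) (y : X) =
        flowTaylor (a (idx y)) g (n + 1) (y : X) + directionalDeriv E g (y : X) (p y) := by
    intro y₀
    obtain ⟨U', hyU', B, hB, hBs⟩ := G.locallyInduced _ _ (hp (idx y₀)) ⟨y₀, hidx y₀⟩
    have hW : U (idx y₀) ⊓ U' ≤ U (idx y₀) := inf_le_left
    have hW' : U (idx y₀) ⊓ U' ≤ U' := inf_le_right
    obtain ⟨b, hb⟩ := exists_restrict_timeField hW (a (idx y₀))
    let B' : F.LieSections hF (U (idx y₀) ⊓ U') :=
      ⟨fun x => B ⟨x, hW' x.2⟩, F.restrict _ _ hW' _ hB⟩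
    have hB' : B' ∈ G.fields hF (U (idx y₀) ⊓ U') := by
      have : pullback Y B'.val = fun y : trace Y (U (idx y₀) ⊓ U') =>
          h (idx y₀) ⟨y, y.2.1⟩ - p y :=
        funext fun y => (hBs ⟨y, y.2.1⟩ y.2.2).symm
      exact (congrArg (· ∈ G.sec (trace Y (U (idx y₀) ⊓ U'))) this).mpr
        (G.restrict _ (trace Y (U (idx y₀) ⊓ U')) (fun y hy => hy.1) _ (hp (idx y₀)))
    obtain ⟨b', hb', hT⟩ := InducedSubsheaf.exists_isAdmissibleField_succ hG
      ((hadm (idx y₀)).restrict hW hb) hB'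
    refine ⟨_, b', ⟨hidx y₀, hyU'⟩, hb', fun y hy g hg => ⟨fun k hk => ?_, ?_⟩⟩
    · rw [(hT y hy g hg).1 k hk, flowTaylor_restrict hW hb hy]
      exact hagree _ _ y (hW hy) (hidx y) g hg k hk
    · have hBy : B'.val ⟨(y : X), hy⟩ = h (idx y₀) ⟨y, hW hy⟩ - p y := (hBs ⟨y, hW hy⟩ hy.2).symm
      rw [(hT y hy g hg).2, flowTaylor_restrict hW hb hy, hBy, map_sub,
        hh (idx y₀) ⟨y, hW hy⟩ g hg]
      ring
  choose W b hyW hb hbT using hlocal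
  choose σ hσ using fun y : Y => exists_isInducedBy_timeField (b y) (hyW y) (n + 1)
  have hσb : ∀ y₀ y : Y, (y : X) ∈ W y₀ → ∀ (g : X → ℂ)
      (hg : ContMDiffAt 𝓘(ℂ, E) 𝓘(ℂ) ω g (y : X)), σ y (germAt g hg) =
        truncatedSum (n + 1) fun k => (k.factorial : ℂ)⁻¹ * flowTaylor (b y₀) g k (y : X) := by
    intro y₀ y hy g hg
    rw [(isInducedBy_timeField_iff (b y) (hyW y) _).1 (hσ y) g hg]
    refine truncatedSum_eq_iff.2 fun k hk => congrArg _ ?_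
    rcases hk.lt_or_eq with hk | rfl
    · rw [(hbT y y (hyW y) g hg).1 k (by omega), (hbT y₀ y hy g hg).1 k (by omega)]
    · rw [(hbT y y (hyW y) g hg).2, (hbT y₀ y hy g hg).2]
  refine ⟨⟨σ, fun y₀ g hg => ⟨fun k x => (k.factorial : ℂ)⁻¹ * flowTaylor (b y₀) g k x,
    fun k => contMDiffAt_const.mul (contMDiffAt_flowTaylor (b y₀) (hyW y₀) hg k), ?_⟩⟩,
    fun y => Jet.ext fun g hg => ?_, Y, W, fun y => timeField (b y), fun y hy => ⟨⟨y, hy⟩, hyW _⟩,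
    hb, fun y₀ y hy => (isInducedBy_timeField_iff (b y₀) hy _).2 (hσb y₀ y hy)⟩
  · filter_upwards [(trace Y (W y₀)).isOpen.mem_nhds (hyW y₀)] with y hy g' using hσb y₀ y hy g g'
  · rw [Jet.truncate_apply (hσb y y (hyW y) g hg), hτa (idx y) y (hidx y) g hg]
    exact truncatedSum_eq_iff.2 fun k hk => congrArg _ ((hbT y y (hyW y) g hg).1 k hk)

end Lifting

end JetLift

end

theorem proposition4p3 {E X : Type u} [NormedAddCommGroup E] [NormedSpace ℂ E]
    [FiniteDimensional ℂ E] [TopologicalSpace X] [T2Space X] [ChartedSpace E X]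
    [IsManifold 𝓘(ℂ, E) ω X]
    (F : JetLift.VectorFieldSheaf E X) (hF : F.LieClosed)
    (Y : Set X) (hY : JetLift.IsReducedSubspace E Y)
    (G : JetLift.InducedSubsheaf F Y) (hG : G.IsObstructionSheaf)
    (hH : Subsingleton (Sheaf.H G.toSheaf 1))
    (n : ℕ) (hn : 1 ≤ n) (τ : JetLift.JetSection E Y n) (hτ : τ.IsAdmissible G) :
    ∃ τ' : JetLift.JetSection E Y (n + 1),
      (∀ y : Y, (τ'.toFun y).truncate = τ.toFun y) ∧ τ'.IsAdmissible G := by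
  have := FiniteDimensional.complete ℂ E
  exact hτ.exists_lift hF hG hH hn
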